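/- Let $m\ge 1$ be an integer and, for $j=1,\dots,2m$, let $\omega_j=(\cos\frac{\pi j}{m},\sin\frac{\pi j}{m})\in S^1$. Let $\psi\in C^\infty(S^1)$ be even (complex-valued allowed). Let $f\in\mathcal E'(\mathbb R^2)$ be a compactly supported (complex-valued) distribution. For $\omega\in S^1$ let $\mathcal Rf(\omega,\cdot)\in\mathcal E'(\mathbb R)$ be its Radon transform, $\mathcal Rf(\omega,p)=\int_{x\cdot\omega=p}f\,d\ell$, which for distributions means $\langle\mathcal Rf(\omega,\cdot),\phi\rangle=\langle f,\phi(x\cdot\omega)\rangle$ for $\phi\in C^\infty(\mathbb R)$. Let $\mathcal H=\frac1{4\pi}H\,\frac{d}{dp}$, where $Hg(p)=\frac1\pi\,\mathrm{p.v.}\!\int\frac{g(s)}{p-s}\,ds$ is the Hilbert transform, extended to $\mathcal E'(\mathbb R)$ by duality, $\langle Hg,\phi\rangle=-\langle g,H\phi\rangle$ for $\phi\in C_c^\infty(\mathbb R)$. Define the distribution $$f_{\psi,\delta}(x)=\frac{2\pi}{m}\sum_{j=1}^m\psi(\omega_j)\,(\mathcal H\mathcal Rf)(\omega_j,x\cdot\omega_j)\in\mathcal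 D'(\mathbb R^2),$$ where $v(x\cdot\omega)$ denotes the pullback of $v\in\mathcal D'(\mathbb R)$ under $x\mapsto x\cdot\omega$. Then $$\mathrm{WF}(f_{\psi,\delta})\subset\bigcup_{j=1}^{2m}\ \bigcup_{x_0:\,(x_0,\omega_j)\in \mathrm{WF}(f)}N^*\{x:(x-x_0)\cdot\omega_j=0\}.$$ Here $\mathrm{WF}$ is the ($C^\infty$) wave front set, covectors are identified with vectors by the Euclidean inner product, and $N^*L$ is the conormal bundle of the line $L$. That is, if $(x,\xi)\in\mathrm{WF}(f_{\psi,\delta})$, then there are $j\in\{1,\dots,2m\}$ and $x_0\in\mathbb R^2$ with $(x_0,\omega_j)\in\mathrm{WF}(f)$, $(x-x_0)\cdot\omega_j=0$ and $\xi$ parallel to $\omega_j$. -/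

import Mathlib

open MeasureTheory Set Filter Topology TopologicalSpace
open scoped ContDiff Distributions Manifold

noncomputable section

namespace RadonWF

/-! ### Distributions and compactly supported distributions -/

section Distributions

variable (V : Type*) [NormedAddCommGroup V] [NormedSpace ℝ V]

/-- Complex-valued test functions `C_c^∞(V)` with the canonical LF topology. -/
abbrev Test : Type _ := TestFunction (⊤ : Opens V) ℂ ⊤

/-- Distributions on `V`: continuous linear functionals on `C_c^∞(V)`. -/
abbrev Dist : Type _ := Test V →L[ℂ] ℂ

/-- The space `C^∞(V)` of smooth complex-valued functions. -/
def Smooth : Submodule ℂ (V → ℂ) where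
  carrier := {φ | ContDiff ℝ ∞ φ}
  add_mem' := by
    intro φ χ hφ hχ
    rw [mem_ofPred_eq] at *
    exact hφ.add hχ
  zero_mem' := by
    rw [mem_ofPred_eq]
    exact contDiff_const
  smul_mem' := by
    intro c φ hφ
    rw [mem_ofPred_eq] at *
    exact hφ.const_smul c

variable {V} in
theorem smooth_contDiff (φ : Smooth V) : ContDiff ℝ ∞ (φ : V → ℂ) := φ.2

/-- The space `ℰ'(V)` of compactly supported distributions, as the dual of `C^∞(V)` with the
topology of uniform convergence of all derivatives on compact sets: continuity of the functional
means `|u(φ)| ≤ C max_{n ≤ N} sup_K |D^n φ|` for some compact `K` and some `N`, `C`. -/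
structure CompactDist where
  toLin : Smooth V →ₗ[ℂ] ℂ
  continuous_toLin : ∃ K : Set V, IsCompact K ∧ ∃ (N : ℕ) (C : ℝ), 0 ≤ C ∧
    ∀ (φ : Smooth V) (B : ℝ), 0 ≤ B →
      (∀ n ≤ N, ∀ x ∈ K, ‖iteratedFDeriv ℝ n (φ : V → ℂ) x‖ ≤ B) → ‖toLin φ‖ ≤ C * B

variable {V}

/-- A criterion for continuity of linear functionals on test functions. -/
theorem continuous_of_bound (L : Test V →ₗ[ℂ] ℂ)
    (h : ∀ K : Compacts V, ∃ (N : ℕ) (C : ℝ), 0 ≤ C ∧ ∀ (φ : Test V) (B : ℝ),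
      (∀ x ∉ K, φ x = 0) → 0 ≤ B → (∀ n ≤ N, ∀ x, ‖iteratedFDeriv ℝ n φ x‖ ≤ B) →
        ‖L φ‖ ≤ C * B) : Continuous L := by
  rw [TestFunction.continuous_iff_continuous_comp]
  intro K hK
  obtain ⟨N, C, hC, h⟩ := h K
  refine (ContDiffMapSupportedIn.mkCLMtoNormedSpace (𝕜 := ℂ)
    (fun φ : ContDiffMapSupportedIn V ℂ ⊤ K => L (TestFunction.ofSupportedIn hK φ))
    (fun f g => ?_) (fun c f => ?_) ⟨Finset.range (N + 1), C, hC, fun φ => ?_⟩).continuous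
  · rw [← map_add]; rfl
  · rw [← map_smul]; rfl
  · refine h _ _ (fun x hx => φ.zero_on_compl hx) (apply_nonneg _ _) fun n hn x => ?_
    refine (ContDiffMapSupportedIn.norm_iteratedFDeriv_apply_le_seminorm_top ℂ
      (f := φ) (i := n) (x := x)).trans ?_
    exact Seminorm.le_finset_sup_apply (Finset.mem_range.2 (Nat.lt_succ_of_le hn))

/-- A test function as a smooth function. -/
def Test.smooth (φ : Test V) : Smooth V := ⟨φ, φ.contDiff⟩

/-- The inclusion of `ℰ'(V)` into the space of distributions. -/
def CompactDist.toDist (f : CompactDist V) : Dist V where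
  toFun φ := f.toLin φ.smooth
  map_add' φ χ := f.toLin.map_add φ.smooth χ.smooth
  map_smul' c φ := f.toLin.map_smul c φ.smooth
  cont := by
    refine continuous_of_bound
      { toFun := fun φ : Test V => f.toLin φ.smooth
        map_add' := fun φ χ => f.toLin.map_add φ.smooth χ.smooth
        map_smul' := fun c φ => f.toLin.map_smul c φ.smooth } fun K => ?_
    obtain ⟨K', -, N, C, hC, h⟩ := f.continuous_toLin
    exact ⟨N, C, hC, fun φ B _ hB hφ => h φ.smooth B hB fun n hn x _ => hφ n hn x⟩

end Distributions

/-! ### The wave front set -/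

section WaveFront

variable {V : Type*} [NormedAddCommGroup V] [InnerProductSpace ℝ V]

/-- The test function `x ↦ e^{-i x·ξ} φ(x)`. -/
def modulate (φ : Test V) (ξ : V) : Test V where
  toFun x := Complex.exp (-Complex.I * (inner ℝ x ξ : ℝ)) * φ x
  contDiff' := by
    refine ContDiff.mul ?_ φ.contDiff
    exact (contDiff_const.mul
      (Complex.ofRealCLM.contDiff.comp (contDiff_id.inner ℝ contDiff_const))).cexp
  hasCompactSupport' := φ.hasCompactSupport.mul_left
  tsupport_subset' := fun _ _ => trivial

/-- The Fourier transform of the compactly supported distribution `φ u`. -/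
def localFourier (u : Dist V) (φ : Test V) (ξ : V) : ℂ := u (modulate φ ξ)

/-- `u` is microlocally smooth at `(x, ξ)`: for some cutoff `φ` with `φ(x) ≠ 0`, the Fourier
transform of `φ u` is rapidly decreasing in an open conic neighbourhood of `ξ`. -/
def MicrolocallySmoothAt (u : Dist V) (x ξ : V) : Prop :=
  ∃ φ : Test V, φ x ≠ 0 ∧ ∃ Γ : Set V, IsOpen Γ ∧ ξ ∈ Γ ∧ (∀ η ∈ Γ, ∀ t : ℝ, 0 < t → t • η ∈ Γ) ∧
    ∀ N : ℕ, ∃ C : ℝ, ∀ η ∈ Γ, ‖localFourier u φ η‖ ≤ C * (1 + ‖η‖) ^ (-(N : ℤ))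

/-- The wave front set, as a set of pairs (point, nonzero covector); covectors are identified with
vectors by the inner product. -/
def WF (u : Dist V) : Set (V × V) := {q | q.2 ≠ 0 ∧ ¬ MicrolocallySmoothAt u q.1 q.2}

/-- The conormal bundle of an affine subspace `L`: pairs `(x, ξ)` with `x ∈ L` and `ξ` annihilating
the tangent space of `L`. -/
def conormal (L : AffineSubspace ℝ V) : Set (V × V) :=
  {q | q.1 ∈ L ∧ ∀ v ∈ L.direction, inner ℝ q.2 v = (0 : ℝ)}

end WaveFront

/-! ### Geometry of the plane -/

/-- The Euclidean plane. -/
abbrev Plane : Type := EuclideanSpace ℝ (Fin 2)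

/-- The unit circle `S¹` in the plane. -/
abbrev UnitCircle : Type := Metric.sphere (0 : Plane) 1

/-- `ω(θ) = (cos θ, sin θ)`. -/
def direction (θ : ℝ) : UnitCircle :=
  ⟨!₂[Real.cos θ, Real.sin θ], by simp [EuclideanSpace.norm_eq]⟩

/-- The sampled directions `ω_j = ω(π j / m)`. There are `2m` of them, `j = 1, …, 2m`. -/
def sampled (m j : ℕ) : UnitCircle := direction (Real.pi * j / m)

/-- The rotation `ω^⊥ = (-ω₂, ω₁)` by a right angle. -/
def perp (w : Plane) : Plane := !₂[-w 1, w 0]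

/-- The line `{x | (x - x₀)·ω = 0}`. -/
def lineThrough (x₀ w : Plane) : AffineSubspace ℝ Plane where
  carrier := {x | inner ℝ (x - x₀) w = (0 : ℝ)}
  smul_vsub_vadd_mem' := by
    intro c p₁ p₂ p₃ h₁ h₂ h₃
    simp only [mem_ofPred_eq, vsub_eq_sub, vadd_eq_add] at *
    have : c • (p₁ - p₂) + p₃ - x₀ = c • ((p₁ - x₀) - (p₂ - x₀)) + (p₃ - x₀) := by
      module
    rw [this, inner_add_left, inner_smul_left, inner_sub_left, h₁, h₂, h₃]
    simp

/-! ### Differentiation of parametric integrals -/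

theorem iteratedDeriv_integral {μ : Measure ℝ} {h : ℕ → ℝ → ℝ → ℂ}
    (hd : ∀ n p t, HasDerivAt (fun q => h n q t) (h (n + 1) p t) p)
    (hm : ∀ n p, AEStronglyMeasurable (h n p) μ)
    (hb : ∀ n (R : ℝ), ∃ b : ℝ → ℝ, Integrable b μ ∧ ∀ᵐ t ∂μ, ∀ p, |p| ≤ R → ‖h n p t‖ ≤ b t) :
    (∀ n, iteratedDeriv n (fun p => ∫ t, h 0 p t ∂μ) = fun p => ∫ t, h n p t ∂μ) ∧
      ContDiff ℝ ∞ (fun p => ∫ t, h 0 p t ∂μ) := by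
  have hi : ∀ n p, Integrable (h n p) μ := by
    intro n p
    obtain ⟨b, hb1, hb2⟩ := hb n |p|
    exact hb1.mono' (hm n p) (hb2.mono fun t ht => ht p le_rfl)
  have key : ∀ n p, HasDerivAt (fun q => ∫ t, h n q t ∂μ) (∫ t, h (n + 1) p t ∂μ) p := by
    intro n p
    obtain ⟨b, hb1, hb2⟩ := hb (n + 1) (|p| + 1)
    refine (hasDerivAt_integral_of_dominated_loc_of_deriv_le (Metric.ball_mem_nhds p one_pos)
      (Eventually.of_forall fun q => hm n q) (hi n p) (hm (n + 1) p)
      (hb2.mono fun t ht q hq => ht q ?_) hb1 (Eventually.of_forall fun t q _ => hd n q t)).2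
    rw [Metric.mem_ball, Real.dist_eq] at hq
    have := abs_add_le (q - p) p
    rw [sub_add_cancel] at this
    linarith
  have hit : ∀ n, iteratedDeriv n (fun p => ∫ t, h 0 p t ∂μ) = fun p => ∫ t, h n p t ∂μ := by
    intro n
    induction n with
    | zero => simp
    | succ n ih =>
      rw [iteratedDeriv_succ, ih]
      funext p
      exact (key n p).deriv
  refine ⟨hit, contDiff_of_differentiable_iteratedDeriv fun n _ => ?_⟩
  rw [hit n]
  exact fun p => (key n p).differentiableAt

/-! ### The Radon transform -/

/-- The Radon transform `ℛ φ(ω, p) = ∫_{x·ω = p} φ dℓ` of a function, the line `x·ω = p` being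
parametrized by arc length as `t ↦ p ω + t ω^⊥`. -/
def radon (φ : Plane → ℂ) (w : UnitCircle) (p : ℝ) : ℂ :=
  ∫ t : ℝ, φ (p • (w : Plane) + t • perp w)

theorem unit_sq (w : UnitCircle) : (w : Plane) 0 ^ 2 + (w : Plane) 1 ^ 2 = 1 := by
  have h := w.2
  rw [mem_sphere_zero_iff_norm, EuclideanSpace.norm_eq, Real.sqrt_eq_one] at h
  simpa using h

theorem norm_sq_line (w : UnitCircle) (p t : ℝ) :
    ‖p • (w : Plane) + t • perp w‖ ^ 2 = p ^ 2 + t ^ 2 := by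
  have h := unit_sq w
  rw [EuclideanSpace.norm_sq_eq]
  simp [perp]
  linear_combination (p ^ 2 + t ^ 2) * h

theorem abs_le_norm_line (w : UnitCircle) (p t : ℝ) :
    |p| ≤ ‖p • (w : Plane) + t • perp w‖ ∧ |t| ≤ ‖p • (w : Plane) + t • perp w‖ := by
  have h := norm_sq_line w p t
  constructor <;> refine abs_le_of_sq_le_sq ?_ (norm_nonneg _) <;> nlinarith [sq_nonneg p, sq_nonneg t]

/-- Derivatives of the Radon transform in `p`. -/
theorem radon_deriv {φ : Plane → ℂ} (hφ : ContDiff ℝ ∞ φ) {r : ℝ}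
    (hr : ∀ x, r < ‖x‖ → φ x = 0) (w : UnitCircle) :
    ContDiff ℝ ∞ (radon φ w) ∧ ∀ (n : ℕ) (B : ℝ), (∀ x, ‖iteratedFDeriv ℝ n φ x‖ ≤ B) →
      0 ≤ B → ∀ p, ‖iteratedFDeriv ℝ n (radon φ w) p‖ ≤ 2 * |r| * B := by
  have hsupp : tsupport φ ⊆ Metric.closedBall 0 r := by
    refine closure_minimal (fun x hx => ?_) Metric.isClosed_closedBall
    rw [mem_closedBall_zero_iff]
    by_contra hc
    exact hx (hr x (not_le.1 hc))
  have hzero : ∀ n x, r < ‖x‖ → iteratedFDeriv ℝ n φ x = 0 := by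
    intro n x hx
    by_contra hc
    have h := hsupp (support_iteratedFDeriv_subset n hc)
    rw [mem_closedBall_zero_iff] at h
    linarith
  set h : ℕ → ℝ → ℝ → ℂ := fun n p t =>
    iteratedFDeriv ℝ n φ (p • (w : Plane) + t • perp w) (fun _ => (w : Plane)) with hh
  have hle : ∀ n p t, ‖h n p t‖ ≤ ‖iteratedFDeriv ℝ n φ (p • (w : Plane) + t • perp w)‖ := by
    intro n p t
    refine (ContinuousMultilinearMap.le_opNorm _ _).trans ?_
    simp [mem_sphere_zero_iff_norm.1 w.2]
  have hbd : ∀ n (B : ℝ), (∀ x, ‖iteratedFDeriv ℝ n φ x‖ ≤ B) → 0 ≤ B → ∀ p t,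
      ‖h n p t‖ ≤ (Icc (-|r|) |r|).indicator (fun _ => B) t := by
    intro n B hB hB0 p t
    by_cases ht : t ∈ Icc (-|r|) |r|
    · rw [indicator_of_mem ht]
      exact (hle n p t).trans (hB _)
    · rw [indicator_of_notMem ht]
      have h1 : |r| < |t| := by
        by_contra hc
        exact ht (abs_le.1 (not_lt.1 hc))
      have h2 := (abs_le_norm_line w p t).2
      have h3 := hzero n (p • (w : Plane) + t • perp w) (by linarith [le_abs_self r])
      simpa [h3] using hle n p t
  have hint : ∀ B : ℝ, Integrable ((Icc (-|r|) |r|).indicator (fun _ => B)) :=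
    fun B => (integrable_indicator_iff measurableSet_Icc).2
      (integrableOn_const (by simp))
  have hcont : ∀ n, Continuous (iteratedFDeriv ℝ n φ) := fun n =>
    hφ.continuous_iteratedFDeriv (by exact_mod_cast le_top)
  have hcs : HasCompactSupport φ :=
    HasCompactSupport.of_support_subset_isCompact (isCompact_closedBall 0 r)
      ((subset_tsupport φ).trans hsupp)
  have hex : ∀ n, ∃ B, ∀ x, ‖iteratedFDeriv ℝ n φ x‖ ≤ B := fun n =>
    (hcont n).bounded_above_of_compact_support (hcs.iteratedFDeriv n)
  obtain ⟨hit, hcd⟩ := iteratedDeriv_integral (μ := volume) (h := h)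
    (fun n p t => by
      have h1 : HasFDerivAt (iteratedFDeriv ℝ n φ)
          (fderiv ℝ (iteratedFDeriv ℝ n φ) (p • (w : Plane) + t • perp w))
          (p • (w : Plane) + t • perp w) :=
        ((hφ.differentiable_iteratedFDeriv (m := n) (by exact_mod_cast WithTop.coe_lt_top _))
          _).hasFDerivAt
      have h2 : HasDerivAt (fun q : ℝ => q • (w : Plane) + t • perp w) (w : Plane) p := by
        simpa using ((hasDerivAt_id p).smul_const (w : Plane)).add_const (t • perp w)
      have h3 := h1.comp_hasDerivAt p h2
      have h4 := (ContinuousMultilinearMap.apply ℝ (fun _ : Fin n => Plane) ℂ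
        (fun _ => (w : Plane))).hasFDerivAt.comp_hasDerivAt p h3
      exact h4)
    (fun n p => by
      refine Continuous.aestronglyMeasurable ?_
      exact (ContinuousMultilinearMap.apply ℝ (fun _ : Fin n => Plane) ℂ
        (fun _ => (w : Plane))).continuous.comp ((hcont n).comp (by fun_prop)))
    (fun n R => by
      obtain ⟨B, hB⟩ := hex n
      exact ⟨_, hint B, Eventually.of_forall fun t p _ =>
        hbd n B hB ((norm_nonneg _).trans (hB 0)) p t⟩)
  have h0 : (fun p => ∫ t, h 0 p t) = radon φ w := by
    funext p
    simp [hh, radon]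
  rw [h0] at hcd hit
  refine ⟨hcd, fun n B hB hB0 p => ?_⟩
  rw [norm_iteratedFDeriv_eq_norm_iteratedDeriv, hit n]
  refine (norm_integral_le_of_norm_le (hint B) (Eventually.of_forall (hbd n B hB hB0 p))).trans ?_
  rw [integral_indicator measurableSet_Icc]
  simp
  apply le_of_eq
  ring

/-- The Radon transform `ℛ φ(ω, ·)` of a test function on the plane, as a test function on `ℝ`. -/
def radonTest (w : UnitCircle) (φ : Test Plane) : Test ℝ where
  toFun := radon φ w
  contDiff' := by
    obtain ⟨r, hr⟩ := φ.hasCompactSupport.isBounded.subset_closedBall 0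
    refine (radon_deriv φ.contDiff (r := r) (fun x hx => ?_) w).1
    by_contra hc
    have := hr (subset_tsupport _ hc)
    rw [mem_closedBall_zero_iff] at this
    linarith
  hasCompactSupport' := by
    obtain ⟨r, hr⟩ := φ.hasCompactSupport.isBounded.subset_closedBall 0
    refine HasCompactSupport.of_support_subset_isCompact (isCompact_closedBall (0 : ℝ) r) ?_
    intro p hp
    rw [mem_closedBall_zero_iff, Real.norm_eq_abs]
    by_contra hc
    refine hp ?_
    have : ∀ t : ℝ, φ (p • (w : Plane) + t • perp w) = 0 := by
      intro t
      by_contra hc'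
      have h1 := hr (subset_tsupport _ hc')
      rw [mem_closedBall_zero_iff] at h1
      have h2 := (abs_le_norm_line w p t).1
      linarith
    simp [radon, this]
  tsupport_subset' := fun _ _ => trivial

theorem integrable_line (w : UnitCircle) (φ : Test Plane) (p : ℝ) :
    Integrable (fun t : ℝ => φ (p • (w : Plane) + t • perp w)) := by
  refine Continuous.integrable_of_hasCompactSupport (by fun_prop) ?_
  obtain ⟨r, hr⟩ := φ.hasCompactSupport.isBounded.subset_closedBall 0
  refine HasCompactSupport.of_support_subset_isCompact (isCompact_closedBall (0 : ℝ) r) ?_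
  intro t ht
  have h1 := hr (subset_tsupport _ ht)
  rw [mem_closedBall_zero_iff] at h1 ⊢
  exact (abs_le_norm_line w p t).2.trans h1

/-- The map `φ ↦ ℛ φ(ω, ·)` from `C_c^∞(ℝ²)` to `C_c^∞(ℝ)` is linear and continuous. -/
def radonCLM (w : UnitCircle) : Test Plane →L[ℂ] Test ℝ :=
  TestFunction.mkCLM ℂ (radonTest w)
    (fun φ χ => by
      ext p
      exact integral_add (integrable_line w φ p) (integrable_line w χ p))
    (fun c φ => by
      ext p
      exact integral_const_mul c _)
    (fun K _ => by
      obtain ⟨r, hr⟩ := K.isCompact.isBounded.subset_closedBall 0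
      have hz : ∀ (φ : ContDiffMapSupportedIn Plane ℂ ⊤ K) x, r < ‖x‖ → φ x = 0 := by
        intro φ x hx
        refine φ.zero_on_compl fun hc => ?_
        have := hr hc
        rw [mem_closedBall_zero_iff] at this
        linarith
      let K' : Compacts ℝ := ⟨Metric.closedBall 0 r, isCompact_closedBall 0 r⟩
      have hint : ∀ (φ : ContDiffMapSupportedIn Plane ℂ ⊤ K) (p : ℝ),
          Integrable (fun t : ℝ => φ (p • (w : Plane) + t • perp w)) := fun φ p =>
        integrable_line w (TestFunction.ofSupportedIn (fun _ _ => trivial) φ) p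
      let T : ContDiffMapSupportedIn Plane ℂ ⊤ K →ₗ[ℂ] ContDiffMapSupportedIn ℝ ℂ ⊤ K' :=
        { toFun := fun φ => ⟨radon φ w, (radon_deriv φ.contDiff (hz φ) w).1, fun p hp => by
            have h0 : ∀ t : ℝ, φ (p • (w : Plane) + t • perp w) = 0 := by
              intro t
              refine hz φ _ ?_
              have h1 : r < |p| := by
                by_contra hc
                exact hp (mem_closedBall_zero_iff.2 (not_lt.1 hc))
              exact h1.trans_le (abs_le_norm_line w p t).1
            simp [radon, h0]⟩
          map_add' := fun φ χ => by
            ext p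
            exact integral_add (hint φ p) (hint χ p)
          map_smul' := fun c φ => by
            ext p
            exact integral_const_mul c _ }
      have hT : Continuous T := by
        refine WithSeminorms.continuous_of_isBounded (ContDiffMapSupportedIn.withSeminorms ℂ Plane ℂ ⊤ K)
          (ContDiffMapSupportedIn.withSeminorms ℂ ℝ ℂ ⊤ K') _ (Seminorm.IsBounded.of_real fun n => ?_)
        refine ⟨{n}, 2 * |r|, fun φ => ?_⟩
        refine ((T φ).seminorm_top_le_iff ℂ
          (mul_nonneg (by positivity) (apply_nonneg _ _)) n).2 fun p _ => ?_
        rw [Finset.sup_singleton]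
        exact (radon_deriv φ.contDiff (hz φ) w).2 n _
          (fun x => ContDiffMapSupportedIn.norm_iteratedFDeriv_apply_le_seminorm_top ℂ)
          (apply_nonneg _ _) p
      have h2 : Continuous (TestFunction.ofSupportedIn (n := ⊤) (F := ℂ)
          (K := K') (Ω := ⊤) (fun _ _ => trivial)) := TestFunction.continuous_ofSupportedIn _
      exact h2.comp hT)

/-- The pullback `x ↦ v(x·ω)` of a distribution `v` on `ℝ` under `x ↦ x·ω`, that is
`⟨v(x·ω), φ⟩ = ⟨v, ℛ φ(ω, ·)⟩` (by Fubini, the usual formula when `v` is a function). -/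
def ridge (w : UnitCircle) (v : Dist ℝ) : Dist Plane := v.comp (radonCLM w)

/-- The function `x ↦ φ(x·ω)` on the plane. -/
def Smooth.ridge (w : UnitCircle) (φ : Smooth ℝ) : Smooth Plane :=
  ⟨fun x => φ.1 (inner ℝ x (w : Plane)),
    (smooth_contDiff φ).comp (contDiff_id.inner ℝ contDiff_const)⟩

/-- The Radon transform `ℛ f(ω, ·) ∈ ℰ'(ℝ)` of `f ∈ ℰ'(ℝ²)` at the direction `ω`, given by duality:
`⟨ℛ f(ω, ·), φ⟩ = ⟨f, φ(x·ω)⟩` (by Fubini, the usual formula when `f` is a function). -/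
def CompactDist.radon (w : UnitCircle) (f : CompactDist Plane) : CompactDist ℝ where
  toLin :=
    { toFun := fun φ => f.toLin (Smooth.ridge w φ)
      map_add' := fun φ χ => f.toLin.map_add (Smooth.ridge w φ) (Smooth.ridge w χ)
      map_smul' := fun c φ => f.toLin.map_smul c (Smooth.ridge w φ) }
  continuous_toLin := by
    obtain ⟨K, hK, N, C, hC, h⟩ := f.continuous_toLin
    let g : Plane →L[ℝ] ℝ := innerSL ℝ (w : Plane)
    have hg : ‖g‖ = 1 := by
      rw [innerSL_apply_norm]
      exact mem_sphere_zero_iff_norm.1 w.2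
    refine ⟨g '' K, hK.image g.continuous, N, C, hC, fun φ B hB hφ => ?_⟩
    refine h (Smooth.ridge w φ) B hB fun n hn x hx => ?_
    have h1 : ((Smooth.ridge w φ : Smooth Plane) : Plane → ℂ) = (φ : ℝ → ℂ) ∘ g := by
      funext y
      simp [Smooth.ridge, g, real_inner_comm]
    rw [h1, g.iteratedFDeriv_comp_right (n := ∞) (smooth_contDiff φ) x (by exact_mod_cast le_top)]
    refine (ContinuousMultilinearMap.norm_compContinuousLinearMap_le _ _).trans ?_
    simp only [hg, Finset.prod_const_one, mul_one]
    exact hφ n hn (g x) (mem_image_of_mem g hx)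

/-! ### The Hilbert transform and the filter -/

/-- The Hilbert transform `H g(p) = (1/π) p.v. ∫ g(s) / (p - s) ds` of a function on `ℝ`. -/
def hilbert (g : ℝ → ℂ) (p : ℝ) : ℂ :=
  (1 / Real.pi : ℂ) * limUnder (𝓝[>] (0 : ℝ))
    (fun ε : ℝ => ∫ s in {s : ℝ | ε < |p - s|}, g s / ((p - s : ℝ) : ℂ))

/-- The symmetrized integrand of the Hilbert transform. -/
theorem hilbert_integrand_bound {g : ℝ → ℂ} (hg : ContDiff ℝ 1 g) {r B R : ℝ}
    (hr : ∀ s, r < |s| → g s = 0) (hB : ∀ s, ‖deriv g s‖ ≤ B) {p t : ℝ} (hp : |p| ≤ R)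
    (ht : 0 < t) :
    ‖(g (p - t) - g (p + t)) / (t : ℂ)‖ ≤ (Ioc 0 (|r| + |R|)).indicator (fun _ => 2 * B) t := by
  by_cases hT : t ≤ |r| + |R|
  · rw [indicator_of_mem (show t ∈ Ioc 0 (|r| + |R|) from ⟨ht, hT⟩), norm_div, Complex.norm_real,
      Real.norm_eq_abs, abs_of_pos ht, div_le_iff₀ ht]
    have h1 := Convex.norm_image_sub_le_of_norm_deriv_le (s := univ) (𝕜 := ℝ) (f := g) (C := B)
      (fun x _ => hg.differentiable one_ne_zero x) (fun x _ => hB x) convex_univ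
      (mem_univ (p + t)) (mem_univ (p - t))
    refine h1.trans (le_of_eq ?_)
    have : p - t - (p + t) = -(2 * t) := by ring
    rw [this, norm_neg, Real.norm_eq_abs, abs_of_pos (by positivity)]
    ring
  · rw [indicator_of_notMem (fun h => hT h.2)]
    have h2 := abs_le.1 hp
    have h3 := le_abs_self r
    have h4 := le_abs_self R
    have h5 : r < |p - t| := by
      rw [lt_abs]; right; linarith
    have h6 : r < |p + t| := by
      rw [lt_abs]; left; linarith
    simp [hr _ h5, hr _ h6]

theorem hilbert_integrand_meas {g : ℝ → ℂ} (hg : Continuous g) (p : ℝ) :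
    AEStronglyMeasurable (fun t : ℝ => (g (p - t) - g (p + t)) / (t : ℂ))
      (volume.restrict (Ioi 0)) := by
  refine ContinuousOn.aestronglyMeasurable ?_ measurableSet_Ioi
  refine ContinuousOn.div (by fun_prop) (by fun_prop) fun t ht => ?_
  exact_mod_cast (ne_of_gt ht)

theorem integrable_indicator_Ioc (T B : ℝ) :
    Integrable ((Ioc 0 T).indicator (fun _ => B)) (volume.restrict (Ioi (0 : ℝ))) :=
  ((integrable_indicator_iff measurableSet_Ioc).2 (integrableOn_const (by simp))).restrict

/-- On test functions the principal value exists, and can be written as an absolutely convergent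
integral. -/
theorem hilbert_eq {g : ℝ → ℂ} (hg : ContDiff ℝ 1 g) (hc : HasCompactSupport g) (p : ℝ) :
    Tendsto (fun ε : ℝ => ∫ s in {s : ℝ | ε < |p - s|}, g s / ((p - s : ℝ) : ℂ)) (𝓝[>] 0)
      (𝓝 (∫ t in Ioi (0 : ℝ), (g (p - t) - g (p + t)) / (t : ℂ))) ∧
    hilbert g p = (1 / Real.pi : ℂ) * ∫ t in Ioi (0 : ℝ), (g (p - t) - g (p + t)) / (t : ℂ) := by
  suffices h : Tendsto (fun ε : ℝ => ∫ s in {s : ℝ | ε < |p - s|}, g s / ((p - s : ℝ) : ℂ))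
      (𝓝[>] 0) (𝓝 (∫ t in Ioi (0 : ℝ), (g (p - t) - g (p + t)) / (t : ℂ))) by
    exact ⟨h, by rw [hilbert, h.limUnder_eq]⟩
  obtain ⟨r, hr⟩ := hc.isBounded.subset_closedBall 0
  have hr' : ∀ s, r < |s| → g s = 0 := by
    intro s hs
    by_contra hcon
    have := hr (subset_tsupport _ hcon)
    rw [mem_closedBall_zero_iff, Real.norm_eq_abs] at this
    linarith
  obtain ⟨B, hB⟩ := (hg.continuous_deriv le_rfl).bounded_above_of_compact_support hc.deriv
  have hint : Integrable (fun t : ℝ => (g (p - t) - g (p + t)) / (t : ℂ))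
      (volume.restrict (Ioi 0)) :=
    (integrable_indicator_Ioc (|r| + |(|p|)|) (2 * B)).mono' (hilbert_integrand_meas hg.continuous p)
      ((ae_restrict_mem measurableSet_Ioi).mono fun t ht =>
        hilbert_integrand_bound hg hr' hB le_rfl ht)
  have hlim := (aecover_Ioi_of_Ioi (μ := volume) (A := (0 : ℝ)) (l := 𝓝[>] (0 : ℝ))
    (a := fun ε => ε) (tendsto_nhdsWithin_of_tendsto_nhds tendsto_id)).integral_tendsto_of_countably_generated
      hint
  refine hlim.congr' ?_
  filter_upwards [self_mem_nhdsWithin] with ε hε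
  rw [mem_Ioi] at hε
  rw [Measure.restrict_restrict measurableSet_Ioi,
    inter_eq_left.2 (Ioi_subset_Ioi hε.le)]
  have hgi : Integrable g := hg.continuous.integrable_of_hasCompactSupport hc
  have hdiv : ∀ f : ℝ → ℂ, Continuous f → Integrable f →
      IntegrableOn (fun t : ℝ => f t / (t : ℂ)) (Ioi ε) := by
    intro f hf hfi
    refine (hfi.norm.div_const ε).integrableOn.mono' ?_ ?_
    · refine ContinuousOn.aestronglyMeasurable ?_ measurableSet_Ioi
      refine ContinuousOn.div (by fun_prop) (by fun_prop) fun t ht => ?_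
      exact_mod_cast (ne_of_gt (hε.trans ht))
    · filter_upwards [ae_restrict_mem measurableSet_Ioi] with t ht
      rw [mem_Ioi] at ht
      rw [norm_div, Complex.norm_real, Real.norm_eq_abs, abs_of_pos (hε.trans ht)]
      gcongr
  have h1 := hdiv (fun t => g (p - t)) (by fun_prop) (hgi.comp_sub_left p)
  have h2 := hdiv (fun t => g (p + t)) (by fun_prop) (hgi.comp_add_left p)
  have hset : MeasurableSet {s : ℝ | ε < |p - s|} :=
    measurableSet_lt measurable_const (by fun_prop)
  rw [← integral_indicator hset,
    ← integral_sub_left_eq_self _ volume p]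
  have h3 : (fun t : ℝ => {s : ℝ | ε < |p - s|}.indicator
      (fun s => g s / ((p - s : ℝ) : ℂ)) (p - t)) =
      (Ioi ε ∪ Iio (-ε)).indicator (fun t : ℝ => g (p - t) / (t : ℂ)) := by
    funext t
    have h4 : p - t ∈ {s : ℝ | ε < |p - s|} ↔ t ∈ Ioi ε ∪ Iio (-ε) := by
      simp only [mem_ofPred_eq, sub_sub_cancel, lt_abs, mem_union, mem_Ioi, mem_Iio, lt_neg]
    by_cases h5 : t ∈ Ioi ε ∪ Iio (-ε)
    · rw [indicator_of_mem h5, indicator_of_mem (h4.2 h5), sub_sub_cancel]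
    · rw [indicator_of_notMem h5, indicator_of_notMem (mt h4.1 h5)]
  have h6 : IntegrableOn (fun t : ℝ => g (p - t) / (t : ℂ)) (Iio (-ε)) := by
    have h := (show IntegrableOn (fun t : ℝ => -(g (p + t) / (t : ℂ))) (Ioi (- -ε)) by
      rw [neg_neg]; exact h2.neg).comp_neg_Iio
    refine h.congr_fun (fun t _ => ?_) measurableSet_Iio
    simp [div_neg, sub_eq_add_neg]
  rw [h3, integral_indicator (measurableSet_Ioi.union measurableSet_Iio),
    setIntegral_union (Set.disjoint_left.2 fun t ht ht' => by
      rw [mem_Ioi] at ht; rw [mem_Iio] at ht'; linarith) measurableSet_Iio h1 h6]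
  have h7 : ∫ t in Iio (-ε), g (p - t) / (t : ℂ) = ∫ t in Ioi ε, -(g (p + t) / (t : ℂ)) := by
    rw [← integral_Iic_eq_integral_Iio, ← integral_comp_neg_Ioi]
    simp [div_neg]
  have h8 : Integrable (fun t : ℝ => -(g (p + t) / (t : ℂ))) (volume.restrict (Ioi ε)) := h2.neg
  rw [h7, ← integral_add h1 h8]
  refine setIntegral_congr_fun measurableSet_Ioi fun t _ => ?_
  ring

/-- Derivatives of the Hilbert transform. -/
theorem hilbert_deriv {g : ℝ → ℂ} (hg : ContDiff ℝ ∞ g) {r : ℝ} (hr : ∀ s, r < |s| → g s = 0) :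
    ContDiff ℝ ∞ (hilbert g) ∧ ∀ (n : ℕ) (B R : ℝ), (∀ s, ‖iteratedFDeriv ℝ (n + 1) g s‖ ≤ B) →
      0 ≤ B → ∀ p, |p| ≤ R → ‖iteratedFDeriv ℝ n (hilbert g) p‖ ≤ (|r| + |R|) * (2 * B) := by
  have hsupp : tsupport g ⊆ Metric.closedBall 0 r := by
    refine closure_minimal (fun x hx => ?_) Metric.isClosed_closedBall
    rw [mem_closedBall_zero_iff]
    by_contra hc
    exact hx (hr x (not_le.1 hc))
  have hcs : HasCompactSupport g :=
    HasCompactSupport.of_support_subset_isCompact (isCompact_closedBall 0 r)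
      ((subset_tsupport g).trans hsupp)
  have hcd : ∀ n, ContDiff ℝ ∞ (iteratedDeriv n g) := by
    intro n
    induction n with
    | zero => simpa using hg
    | succ n ih =>
      rw [iteratedDeriv_succ]
      exact (contDiff_infty_iff_deriv.1 ih).2
  have hz : ∀ n s, r < |s| → iteratedDeriv n g s = 0 := by
    intro n s hs
    by_contra hc
    have h1 : iteratedFDeriv ℝ n g s ≠ 0 := by
      intro h0
      rw [iteratedDeriv_eq_iteratedFDeriv, h0] at hc
      exact hc rfl
    have h := hsupp (support_iteratedFDeriv_subset n h1)
    rw [mem_closedBall_zero_iff, Real.norm_eq_abs] at h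
    linarith
  have hder : ∀ n s, ‖deriv (iteratedDeriv n g) s‖ = ‖iteratedFDeriv ℝ (n + 1) g s‖ := by
    intro n s
    rw [norm_iteratedFDeriv_eq_norm_iteratedDeriv, iteratedDeriv_succ]
  have hex : ∀ n, ∃ B, ∀ x, ‖iteratedFDeriv ℝ n g x‖ ≤ B := fun n =>
    (hg.continuous_iteratedFDeriv (by exact_mod_cast le_top)).bounded_above_of_compact_support
      (hcs.iteratedFDeriv n)
  obtain ⟨hit, hcd'⟩ := iteratedDeriv_integral (μ := volume.restrict (Ioi (0 : ℝ)))
    (h := fun n p t => (iteratedDeriv n g (p - t) - iteratedDeriv n g (p + t)) / (t : ℂ))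
    (fun n p t => by
      have h1 : ∀ s, HasDerivAt (iteratedDeriv n g) (iteratedDeriv (n + 1) g s) s := by
        intro s
        rw [iteratedDeriv_succ]
        exact ((hcd n).differentiable (by simp) s).hasDerivAt
      exact (((h1 (p - t)).comp_sub_const p t).sub ((h1 (p + t)).comp_add_const p t)).div_const _)
    (fun n p => hilbert_integrand_meas (hcd n).continuous p)
    (fun n R => by
      obtain ⟨B, hB⟩ := hex (n + 1)
      refine ⟨_, integrable_indicator_Ioc (|r| + |R|) (2 * B), ?_⟩
      filter_upwards [ae_restrict_mem measurableSet_Ioi] with t ht p hp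
      exact hilbert_integrand_bound ((hcd n).of_le (by simp)) (hz n)
        (fun s => (hder n s).le.trans (hB s)) hp ht)
  have h0 : hilbert g = fun p => (1 / Real.pi : ℂ) * ∫ t in Ioi (0 : ℝ),
      (iteratedDeriv 0 g (p - t) - iteratedDeriv 0 g (p + t)) / (t : ℂ) := by
    funext p
    rw [(hilbert_eq (hg.of_le (by simp)) hcs p).2]
    simp
  refine ⟨by rw [h0]; exact contDiff_const.mul hcd', fun n B R hB hB0 p hp => ?_⟩
  rw [norm_iteratedFDeriv_eq_norm_iteratedDeriv, h0,
    iteratedDeriv_const_mul_field, hit n, norm_mul]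
  have hpi : ‖(1 / Real.pi : ℂ)‖ ≤ 1 := by
    rw [norm_div, Complex.norm_real, norm_one, Real.norm_eq_abs, abs_of_pos Real.pi_pos]
    rw [div_le_one Real.pi_pos]
    linarith [Real.pi_gt_three]
  have hI : ‖∫ t in Ioi (0 : ℝ), (iteratedDeriv n g (p - t) - iteratedDeriv n g (p + t)) / (t : ℂ)‖
      ≤ (|r| + |R|) * (2 * B) := by
    refine (norm_integral_le_of_norm_le (integrable_indicator_Ioc (|r| + |R|) (2 * B)) ?_).trans ?_
    · filter_upwards [ae_restrict_mem measurableSet_Ioi] with t ht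
      exact hilbert_integrand_bound ((hcd n).of_le (by simp)) (hz n)
        (fun s => (hder n s).le.trans (hB s)) hp ht
    · rw [integral_indicator measurableSet_Ioc, Measure.restrict_restrict measurableSet_Ioc,
        inter_eq_left.2 Ioc_subset_Ioi_self]
      simp
      rw [max_eq_left (by positivity)]
  calc _ ≤ 1 * ((|r| + |R|) * (2 * B)) := by gcongr
    _ = _ := one_mul _

theorem test_exists_bound (φ : Test ℝ) : ∃ r, ∀ s, r < |s| → φ s = 0 := by
  obtain ⟨r, hr⟩ := φ.hasCompactSupport.isBounded.subset_closedBall 0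
  refine ⟨r, fun s hs => ?_⟩
  by_contra hcon
  have := hr (subset_tsupport _ hcon)
  rw [mem_closedBall_zero_iff, Real.norm_eq_abs] at this
  linarith

/-- The Hilbert transform of a test function, as a smooth function. -/
def hilbertTest (φ : Test ℝ) : Smooth ℝ :=
  ⟨hilbert φ, (hilbert_deriv φ.contDiff (test_exists_bound φ).choose_spec).1⟩

theorem hilbertTest_apply (φ : Test ℝ) (p : ℝ) : (hilbertTest φ : ℝ → ℂ) p =
    (1 / Real.pi : ℂ) * ∫ t in Ioi (0 : ℝ), (φ (p - t) - φ (p + t)) / (t : ℂ) :=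
  (hilbert_eq (φ.contDiff.of_le (by simp)) φ.hasCompactSupport p).2

theorem integrable_hilbert (φ : Test ℝ) (p : ℝ) :
    Integrable (fun t : ℝ => (φ (p - t) - φ (p + t)) / (t : ℂ)) (volume.restrict (Ioi 0)) := by
  obtain ⟨r, hr⟩ := test_exists_bound φ
  have h1 : ContDiff ℝ 1 φ := φ.contDiff.of_le (by simp)
  obtain ⟨B, hB⟩ := (h1.continuous_deriv le_rfl).bounded_above_of_compact_support
    φ.hasCompactSupport.deriv
  exact (integrable_indicator_Ioc (|r| + |(|p|)|) (2 * B)).mono'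
    (hilbert_integrand_meas φ.continuous p)
    ((ae_restrict_mem measurableSet_Ioi).mono fun t ht =>
      hilbert_integrand_bound h1 hr hB le_rfl ht)

theorem hilbertTest_add (φ χ : Test ℝ) :
    hilbertTest (φ + χ) = hilbertTest φ + hilbertTest χ := by
  refine Subtype.ext (funext fun p => ?_)
  rw [Submodule.coe_add, Pi.add_apply, hilbertTest_apply, hilbertTest_apply, hilbertTest_apply,
    ← mul_add, ← integral_add (integrable_hilbert φ p) (integrable_hilbert χ p)]
  congr 2
  funext t
  change (φ (p - t) + χ (p - t) - (φ (p + t) + χ (p + t))) / (t : ℂ) = _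
  ring

theorem hilbertTest_smul (c : ℂ) (φ : Test ℝ) :
    hilbertTest (c • φ) = c • hilbertTest φ := by
  refine Subtype.ext (funext fun p => ?_)
  rw [Submodule.coe_smul, Pi.smul_apply, hilbertTest_apply, hilbertTest_apply, smul_eq_mul,
    mul_left_comm, ← integral_const_mul c]
  congr 2
  funext t
  change (c * φ (p - t) - c * φ (p + t)) / (t : ℂ) = _
  ring

/-- The derivative of a compactly supported distribution on `ℝ`: `⟨g', φ⟩ = -⟨g, φ'⟩`. -/
def CompactDist.deriv (g : CompactDist ℝ) : CompactDist ℝ where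
  toLin :=
    { toFun := fun φ => -g.toLin ⟨_root_.deriv φ.1, (contDiff_infty_iff_deriv.1 (smooth_contDiff φ)).2⟩
      map_add' := fun φ χ => by
        rw [← neg_add, ← map_add]
        congr 2
        refine Subtype.ext (funext fun p => ?_)
        exact deriv_add ((contDiff_infty_iff_deriv.1 (smooth_contDiff φ)).1 p)
          ((contDiff_infty_iff_deriv.1 (smooth_contDiff χ)).1 p)
      map_smul' := fun c φ => by
        rw [RingHom.id_apply, smul_neg, ← map_smul]
        congr 2
        refine Subtype.ext (funext fun p => ?_)
        exact deriv_const_smul c ((contDiff_infty_iff_deriv.1 (smooth_contDiff φ)).1 p) }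
  continuous_toLin := by
    obtain ⟨K, hK, N, C, hC, h⟩ := g.continuous_toLin
    refine ⟨K, hK, N + 1, C, hC, fun φ B hB hφ => ?_⟩
    refine (norm_neg _).le.trans (h _ B hB fun n hn x hx => ?_)
    have := hφ (n + 1) (by omega) x hx
    rw [norm_iteratedFDeriv_eq_norm_iteratedDeriv, iteratedDeriv_succ'] at this
    rwa [norm_iteratedFDeriv_eq_norm_iteratedDeriv]

/-- The Hilbert transform of a compactly supported distribution on `ℝ`, by duality:
`⟨H g, φ⟩ = -⟨g, H φ⟩`. -/
def CompactDist.hilbert (g : CompactDist ℝ) : Dist ℝ where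
  toFun φ := -g.toLin (hilbertTest φ)
  map_add' φ χ := by rw [hilbertTest_add, map_add, neg_add]
  map_smul' c φ := by rw [hilbertTest_smul, map_smul, RingHom.id_apply, smul_neg]
  cont := by
    refine continuous_of_bound
      { toFun := fun φ : Test ℝ => -g.toLin (hilbertTest φ)
        map_add' := fun φ χ => by rw [hilbertTest_add, map_add, neg_add]
        map_smul' := fun c φ => by
          rw [hilbertTest_smul, map_smul, RingHom.id_apply, smul_neg] } fun K => ?_
    obtain ⟨K', hK', N, C, hC, h⟩ := g.continuous_toLin
    obtain ⟨r, hr⟩ := K.isCompact.isBounded.subset_closedBall 0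
    obtain ⟨R, hR⟩ := hK'.isBounded.subset_closedBall 0
    refine ⟨N + 1, C * ((|r| + |R|) * 2), by positivity, fun φ B hφK hB hφ => ?_⟩
    refine (norm_neg _).le.trans ((h (hilbertTest φ) ((|r| + |R|) * (2 * B)) (by positivity)
      fun n hn x hx => ?_).trans (le_of_eq (by ring)))
    refine (hilbert_deriv φ.contDiff (r := r) fun s hs => hφK s fun hc => ?_).2 n B R
      (hφ (n + 1) (by omega)) hB x ?_
    · have := hr hc
      rw [mem_closedBall_zero_iff, Real.norm_eq_abs] at this
      linarith
    · simpa using hR hx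

/-- The filter `𝓗 = (1/(4π)) H d_p` of the filtered backprojection. -/
def CompactDist.filter (g : CompactDist ℝ) : Dist ℝ :=
  (1 / (4 * Real.pi) : ℂ) • g.deriv.hilbert

/-! ### The direct reconstruction from discrete data -/

/-- The reconstruction
`f_{ψ,δ}(x) = (2π/m) ∑_{j=1}^m ψ(ω_j) (𝓗 ℛ f)(ω_j, x·ω_j)` from the angles `ω_1, …, ω_m`. -/
def reconstruction (m : ℕ) (ψ : UnitCircle → ℂ) (f : CompactDist Plane) : Dist Plane :=
  (2 * Real.pi / m : ℂ) • ∑ j ∈ Finset.Icc 1 m,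
    ψ (sampled m j) • ridge (sampled m j) (f.radon (sampled m j)).filter

end RadonWF

end

/-!
The reconstruction is a finite sum of ridge distributions `v_j (x·ω_j)`, where `v_j` is the filtered
Radon transform of `f` in the direction `ω_j`, up to constants. The claim is that a covector `(x, ξ)`
which is not in the conormal bundle of any of the lines is not singular for any term; a cutoff with
small support around `x` then works for all terms at once.

If `ξ` is not parallel to `ω_j`, the reason is that a ridge is constant along the orthogonal of `ω_j`:
integrating by parts in that direction makes the localized Fourier transform decrease near `ξ`
(`rapidlyDecreasingOn_localFourier_of_dirDeriv`).

If `ξ` is parallel to `ω_j`, then neither `ω_j` nor `-ω_j = ω_{j+m}` is singular for `f` at a point of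
the line `y·ω_j = x·ω_j =: p`. The Radon transform `g` of `f` in the direction `ω_j` is then smooth
near `p` (`exists_rapidlyDecreasingOn_radon_mul`): by the Fourier slice theorem, the Fourier transform
of `χ g` is the restriction to the line through `ω_j` of the Fourier transform of `χ(y·ω_j) f`, a
partition of unity splits `χ(y·ω_j) f` into pieces near single points of the line, and the Fourier
transform of each piece decreases by the localization lemma `CompactDist.rapidlyDecreasingOn_mul`.

The Hilbert transform preserves this smoothness (`exists_rapidlyDecreasingOn_ridge_filter`). Its kernel
is split into a part near the singularity, through which a neighbourhood of `p` only sees the smooth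
part of `g`, and a part away from the singularity, which is smoothing. Both truncated Hilbert
transforms are Fourier multipliers (`truncHilbert_eq_fourier`): the first one has a symbol of linear
growth that acts on rapidly decreasing data, the second one has a rapidly decreasing symbol that acts
on data of polynomial growth. To return to the plane, the localized Fourier transform of a ridge at
`η` is the pairing of the profile with the Radon transform of `e^{-i x·η} φ`, whose Fourier transform
is concentrated at the frequency `ω_j·η` (`exists_concentration_invFourier_radonTest`).

These computations apply a distribution under the sign of a Fourier integral. This is justified by
`CompactDist.toLin_fourier`: by the Hahn–Banach theorem, a compactly supported distribution is a
continuous functional on a Banach space of jets, in which the Fourier integral converges.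
-/

open scoped FourierTransform SchwartzMap ComplexConjugate

noncomputable section

namespace RadonWF

/-! ### Plane waves and compactly supported distributions -/

section Oscillation

variable {V : Type*} [NormedAddCommGroup V] [InnerProductSpace ℝ V]

/-- The plane wave `x ↦ e^{-i x·ξ}`. -/
def osc (ξ : V) : Smooth V :=
  ⟨fun x => Complex.exp (-Complex.I * (inner ℝ x ξ : ℝ)), by
    change ContDiff ℝ ∞ _
    exact (contDiff_const.mul
      (Complex.ofRealCLM.contDiff.comp (contDiff_id.inner ℝ contDiff_const))).cexp⟩

theorem osc_apply (ξ x : V) :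
    (osc ξ : V → ℂ) x = Complex.exp (-Complex.I * (inner ℝ x ξ : ℝ)) := rfl

theorem norm_osc (ξ x : V) : ‖(osc ξ : V → ℂ) x‖ = 1 := by
  have : -Complex.I * (inner ℝ x ξ : ℝ) = ((-inner ℝ x ξ : ℝ) : ℂ) * Complex.I := by
    push_cast; ring
  rw [osc_apply, this, Complex.norm_exp_ofReal_mul_I]

theorem osc_add (ξ η x : V) :
    (osc (ξ + η) : V → ℂ) x = (osc ξ : V → ℂ) x * (osc η : V → ℂ) x := by
  simp only [osc_apply, inner_add_right, ← Complex.exp_add]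
  push_cast
  ring_nf

theorem contDiff_cexp_neg_I : ContDiff ℝ ∞ (fun s : ℝ => Complex.exp (-Complex.I * s)) :=
  (contDiff_const.mul Complex.ofRealCLM.contDiff).cexp

theorem iteratedDeriv_cexp_neg_I (n : ℕ) :
    iteratedDeriv n (fun s : ℝ => Complex.exp (-Complex.I * s)) =
      fun s : ℝ => (-Complex.I) ^ n * Complex.exp (-Complex.I * s) := by
  induction n with
  | zero => simp
  | succ n ih =>
    rw [iteratedDeriv_succ, ih]
    funext s
    have h : HasDerivAt (fun s : ℝ => -Complex.I * (s : ℂ)) (-Complex.I) s := by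
      simpa using (Complex.ofRealCLM.hasDerivAt (x := s)).const_mul (-Complex.I)
    rw [(h.cexp.const_mul ((-Complex.I) ^ n)).deriv]
    ring

theorem iteratedFDeriv_osc (ξ x : V) (n : ℕ) :
    iteratedFDeriv ℝ n (osc ξ : V → ℂ) x =
      (iteratedFDeriv ℝ n (fun s : ℝ => Complex.exp (-Complex.I * s))
        (innerSL ℝ ξ x)).compContinuousLinearMap (fun _ => innerSL ℝ ξ) := by
  have h1 : (osc ξ : V → ℂ) = (fun s : ℝ => Complex.exp (-Complex.I * s)) ∘ innerSL ℝ ξ := by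
    funext y
    simp [osc_apply, real_inner_comm]
  rw [h1, (innerSL ℝ ξ).iteratedFDeriv_comp_right (n := ∞) contDiff_cexp_neg_I x
    (by exact_mod_cast le_top)]

theorem iteratedFDeriv_osc_apply (ξ x : V) (n : ℕ) (v : Fin n → V) :
    iteratedFDeriv ℝ n (osc ξ : V → ℂ) x v =
      (∏ i, (inner ℝ ξ (v i) : ℂ)) * ((-Complex.I) ^ n * (osc ξ : V → ℂ) x) := by
  rw [iteratedFDeriv_osc, ContinuousMultilinearMap.compContinuousLinearMap_apply,
    iteratedFDeriv_apply_eq_iteratedDeriv_mul_prod, iteratedDeriv_cexp_neg_I]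
  simp [osc_apply, real_inner_comm]

theorem norm_iteratedFDeriv_osc_le (ξ x : V) (n : ℕ) :
    ‖iteratedFDeriv ℝ n (osc ξ : V → ℂ) x‖ ≤ ‖ξ‖ ^ n := by
  refine ContinuousMultilinearMap.opNorm_le_bound (by positivity) fun v => ?_
  rw [iteratedFDeriv_osc_apply, norm_mul, norm_mul, norm_pow, norm_neg, Complex.norm_I, one_pow,
    norm_osc, mul_one, mul_one, norm_prod]
  calc ∏ i, ‖((inner ℝ ξ (v i) : ℝ) : ℂ)‖ ≤ ∏ i, (‖ξ‖ * ‖v i‖) := by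
        refine Finset.prod_le_prod (fun _ _ => norm_nonneg _) fun i _ => ?_
        rw [Complex.norm_real]
        exact norm_inner_le_norm _ _
    _ = _ := by rw [Finset.prod_mul_distrib]; simp

theorem continuous_iteratedFDeriv_osc (n : ℕ) :
    Continuous fun q : V × V => iteratedFDeriv ℝ n (osc q.1 : V → ℂ) q.2 := by
  have h : (fun q : V × V => iteratedFDeriv ℝ n (osc q.1 : V → ℂ) q.2) = fun q : V × V =>
      ContinuousMultilinearMap.compContinuousLinearMapContinuousMultilinear ℝ
        (fun _ : Fin n => V) (fun _ => ℝ) ℂ (fun _ => innerSL ℝ q.1)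
        (iteratedFDeriv ℝ n (fun s : ℝ => Complex.exp (-Complex.I * s)) (innerSL ℝ q.1 q.2)) := by
    funext q
    rw [iteratedFDeriv_osc]
    rfl
  rw [h]
  refine Continuous.clm_apply ?_ ?_
  · refine (ContinuousMultilinearMap.cont _).comp (continuous_pi fun _ => ?_)
    exact (innerSL ℝ).continuous.comp continuous_fst
  · refine (contDiff_cexp_neg_I.continuous_iteratedFDeriv (by exact_mod_cast le_top)).comp ?_
    exact ((innerSL ℝ).continuous.comp continuous_fst).clm_apply continuous_snd

end Oscillation

section CompactDistributions

variable {V : Type*} [NormedAddCommGroup V] [NormedSpace ℝ V]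

/-- The pointwise product of smooth functions. -/
def Smooth.mul (χ φ : Smooth V) : Smooth V :=
  ⟨fun x => χ.1 x * φ.1 x, (smooth_contDiff χ).mul (smooth_contDiff φ)⟩

theorem Smooth.mul_apply (χ φ : Smooth V) (x : V) : (Smooth.mul χ φ).1 x = χ.1 x * φ.1 x := rfl

theorem Smooth.exists_bound (χ : Smooth V) {K : Set V} (hK : IsCompact K) (N : ℕ) :
    ∃ C, 0 ≤ C ∧ ∀ n ≤ N, ∀ x ∈ K, ‖iteratedFDeriv ℝ n χ.1 x‖ ≤ C := by
  have h : ∀ n : ℕ, ∃ C, ∀ x ∈ K, ‖iteratedFDeriv ℝ n χ.1 x‖ ≤ C := fun n =>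
    hK.exists_bound_of_continuousOn
      ((smooth_contDiff χ).continuous_iteratedFDeriv (by exact_mod_cast le_top)).continuousOn
  choose C hC using h
  refine ⟨∑ n ∈ Finset.range (N + 1), |C n|, Finset.sum_nonneg fun _ _ => abs_nonneg _,
    fun n hn x hx => ?_⟩
  exact ((hC n x hx).trans (le_abs_self _)).trans (Finset.single_le_sum (f := fun n => |C n|)
    (fun _ _ => abs_nonneg _) (Finset.mem_range.2 (Nat.lt_succ_of_le hn)))

/-- The Leibniz rule as a bound for all derivatives up to a fixed order. -/
theorem norm_iteratedFDeriv_mul_le_of_bounds {φ χ : V → ℂ} (hφ : ContDiff ℝ ∞ φ)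
    (hχ : ContDiff ℝ ∞ χ) {N : ℕ} {B C : ℝ} (x : V)
    (hC : ∀ n ≤ N, ‖iteratedFDeriv ℝ n χ x‖ ≤ C) (hB : ∀ n ≤ N, ‖iteratedFDeriv ℝ n φ x‖ ≤ B) :
    ∀ n ≤ N, ‖iteratedFDeriv ℝ n (fun y => χ y * φ y) x‖ ≤ 2 ^ N * C * B := by
  intro n hn
  have hC0 : 0 ≤ C := (norm_nonneg _).trans (hC 0 (Nat.zero_le _))
  have hB0 : 0 ≤ B := (norm_nonneg _).trans (hB 0 (Nat.zero_le _))
  refine (norm_iteratedFDeriv_mul_le hχ hφ x (n := n) (by exact_mod_cast le_top)).trans ?_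
  calc _ ≤ ∑ i ∈ Finset.range (n + 1), (n.choose i : ℝ) * C * B := by
        refine Finset.sum_le_sum fun i hi => ?_
        have hi' : i ≤ n := Nat.lt_succ_iff.1 (Finset.mem_range.1 hi)
        gcongr
        · exact hC i (hi'.trans hn)
        · exact hB (n - i) ((Nat.sub_le _ _).trans hn)
    _ = 2 ^ n * C * B := by
        rw [← Finset.sum_mul, ← Finset.sum_mul]
        congr 2
        exact_mod_cast Nat.sum_range_choose n
    _ ≤ _ := by
        gcongr
        norm_num

/-- The product of a compactly supported distribution with a smooth function. -/
def CompactDist.mul (χ : Smooth V) (u : CompactDist V) : CompactDist V where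
  toLin :=
    { toFun := fun φ => u.toLin (Smooth.mul χ φ)
      map_add' := fun φ₁ φ₂ => by
        rw [← map_add]
        congr 1
        exact Subtype.ext (funext fun x => mul_add (χ.1 x) (φ₁.1 x) (φ₂.1 x))
      map_smul' := fun c φ => by
        rw [RingHom.id_apply, ← map_smul]
        congr 1
        exact Subtype.ext (funext fun x => mul_left_comm (χ.1 x) c (φ.1 x)) }
  continuous_toLin := by
    obtain ⟨K, hK, N, C, hC, h⟩ := u.continuous_toLin
    obtain ⟨M, hM, hχ⟩ := Smooth.exists_bound χ hK N
    refine ⟨K, hK, N, C * (2 ^ N * M), by positivity, fun φ B hB hφ => ?_⟩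
    rw [mul_assoc C]
    exact h (Smooth.mul χ φ) _ (by positivity) fun n hn x hx =>
      norm_iteratedFDeriv_mul_le_of_bounds (smooth_contDiff φ) (smooth_contDiff χ) x
        (fun n hn => hχ n hn x hx) (fun n hn => hφ n hn x hx) n hn

theorem CompactDist.mul_toLin (χ φ : Smooth V) (u : CompactDist V) :
    (u.mul χ).toLin φ = u.toLin (Smooth.mul χ φ) := rfl

/-- A compactly supported distribution only sees its argument on a sufficiently large ball. -/
theorem CompactDist.exists_ball (u : CompactDist V) :
    ∃ R : ℝ, 0 < R ∧ ∀ φ χ : Smooth V, (∀ x, ‖x‖ < R → φ.1 x = χ.1 x) →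
      u.toLin φ = u.toLin χ := by
  obtain ⟨K, hK, N, C, hC, h⟩ := u.continuous_toLin
  obtain ⟨r, hr⟩ := hK.isBounded.subset_closedBall 0
  refine ⟨|r| + 1, by positivity, fun φ χ heq => ?_⟩
  rw [← sub_eq_zero, ← map_sub, ← norm_le_zero_iff]
  refine (h (φ - χ) 0 le_rfl fun n hn x hx => ?_).trans (by simp)
  have hx' : ‖x‖ < |r| + 1 := by
    have := mem_closedBall_zero_iff.1 (hr hx)
    linarith [le_abs_self r]
  have h0 : ((φ - χ : Smooth V) : V → ℂ) =ᶠ[𝓝 x] 0 := by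
    have : {y : V | ‖y‖ < |r| + 1} ∈ 𝓝 x :=
      (isOpen_lt continuous_norm continuous_const).mem_nhds hx'
    filter_upwards [this] with y hy
    exact sub_eq_zero.2 (heq y hy)
  rw [(h0.iteratedFDeriv ℝ n).eq_of_nhds]
  simp

/-- The normed space of continuous `n`-linear forms, of which the `n`-th derivatives are elements. As a
type of its own it carries no topology but the one of the norm. -/
def MultiForm (V : Type*) [NormedAddCommGroup V] [NormedSpace ℝ V] (n : ℕ) : Type _ :=
  ContinuousMultilinearMap ℝ (fun _ : Fin n => V) ℂ

instance (V : Type*) [NormedAddCommGroup V] [NormedSpace ℝ V] (n : ℕ) :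
    NormedAddCommGroup (MultiForm V n) :=
  inferInstanceAs (NormedAddCommGroup (ContinuousMultilinearMap ℝ (fun _ : Fin n => V) ℂ))

instance (V : Type*) [NormedAddCommGroup V] [NormedSpace ℝ V] (n : ℕ) :
    NormedSpace ℂ (MultiForm V n) :=
  inferInstanceAs (NormedSpace ℂ (ContinuousMultilinearMap ℝ (fun _ : Fin n => V) ℂ))

instance (V : Type*) [NormedAddCommGroup V] [NormedSpace ℝ V] (n : ℕ) :
    CompleteSpace (MultiForm V n) :=
  inferInstanceAs (CompleteSpace (ContinuousMultilinearMap ℝ (fun _ : Fin n => V) ℂ))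

/-- The `n`-th derivative of a smooth function. -/
def derivForm (n : ℕ) (φ : Smooth V) (x : V) : MultiForm V n := iteratedFDeriv ℝ n φ.1 x

theorem continuous_derivForm (n : ℕ) (φ : Smooth V) : Continuous (derivForm n φ) :=
  (smooth_contDiff φ).continuous_iteratedFDeriv (by exact_mod_cast le_top)

/-- The Banach space of families of continuous functions on `K` that can hold the derivatives up to
order `N` of a function on `V`, with the supremum norm. -/
abbrev JetSpace (V : Type*) [NormedAddCommGroup V] [NormedSpace ℝ V] (K : Set V) (N : ℕ) : Type _ :=
  (n : Fin (N + 1)) → C(K, MultiForm V n)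

/-- The derivatives of `φ` up to order `N`, on `K`. -/
def jet (K : Set V) (N : ℕ) : Smooth V →ₗ[ℂ] JetSpace V K N where
  toFun φ n := ⟨fun x => derivForm n φ x, (continuous_derivForm n φ).comp continuous_subtype_val⟩
  map_add' φ χ := by
    funext n
    ext1 x
    exact iteratedFDeriv_add_apply
      ((smooth_contDiff φ).of_le (by exact_mod_cast le_top)).contDiffAt
      ((smooth_contDiff χ).of_le (by exact_mod_cast le_top)).contDiffAt
  map_smul' c φ := by
    funext n
    ext1 x
    exact iteratedFDeriv_const_smul_apply
      ((smooth_contDiff φ).of_le (by exact_mod_cast le_top)).contDiffAt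

theorem jet_apply (K : Set V) (N : ℕ) (φ : Smooth V) (n : Fin (N + 1)) (x : K) :
    jet K N φ n x = derivForm n φ x := rfl

/-- Every compactly supported distribution is a continuous functional of finitely many derivatives
on a compact set, by the Hahn–Banach theorem. -/
theorem CompactDist.exists_jet_functional (u : CompactDist V) :
    ∃ (K : Set V) (N : ℕ) (_ : CompactSpace K),
      ∃ ℓ : JetSpace V K N →L[ℂ] ℂ, ∀ φ : Smooth V, ℓ (jet K N φ) = u.toLin φ := by
  obtain ⟨K, hK, N, C, hC, h⟩ := u.continuous_toLin
  have hKs : CompactSpace K := isCompact_iff_compactSpace.1 hK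
  refine ⟨K, N, hKs, ?_⟩
  set J : Smooth V →ₗ[ℂ] JetSpace V K N := jet K N with hJdef
  have hJ : ∀ φ, ‖u.toLin φ‖ ≤ C * ‖J φ‖ := fun φ =>
    h φ ‖J φ‖ (norm_nonneg _) fun n hn x hx =>
      ((J φ ⟨n, Nat.lt_succ_of_le hn⟩).norm_coe_le_norm ⟨x, hx⟩).trans
        (norm_le_pi_norm (J φ) ⟨n, Nat.lt_succ_of_le hn⟩)
  have hker : LinearMap.ker J ≤ LinearMap.ker u.toLin := fun φ hφ => by
    rw [LinearMap.mem_ker] at hφ ⊢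
    have := hJ φ
    rw [hφ, norm_zero, mul_zero] at this
    exact norm_le_zero_iff.1 this
  -- By `hJ`, the distribution factors through the jets; Hahn–Banach extends the resulting functional
  -- from the range of `J`.
  let q : LinearMap.range J →ₗ[ℂ] ℂ :=
    (LinearMap.ker J).liftQ u.toLin hker ∘ₗ J.quotKerEquivRange.symm.toLinearMap
  have hq : ∀ φ, q ⟨J φ, φ, rfl⟩ = u.toLin φ := fun φ => by
    have : J.quotKerEquivRange.symm ⟨J φ, φ, rfl⟩ = (LinearMap.ker J).mkQ φ :=
      J.quotKerEquivRange_symm_apply_image φ _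
    simp only [q, LinearMap.comp_apply, LinearEquiv.coe_coe]
    rw [this]
    exact (LinearMap.ker J).liftQ_apply _ _
  let q' : StrongDual ℂ (LinearMap.range J) := q.mkContinuous C fun y => by
    obtain ⟨_, φ, rfl⟩ := y
    rw [hq]
    exact hJ φ
  obtain ⟨ℓ, hℓ, -⟩ := exists_extension_norm_eq (LinearMap.range J) q'
  exact ⟨ℓ, fun φ => (hℓ ⟨J φ, φ, rfl⟩).trans (hq φ)⟩

end CompactDistributions

section Fourier

variable {V : Type*} [NormedAddCommGroup V] [InnerProductSpace ℝ V]

/-- The Fourier transform `ξ ↦ ⟨u, e^{-i x·ξ}⟩` of a compactly supported distribution. -/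
def CompactDist.fourier (u : CompactDist V) (ξ : V) : ℂ := u.toLin (osc ξ)

theorem CompactDist.exists_norm_fourier_le (u : CompactDist V) :
    ∃ (C : ℝ) (M : ℕ), 0 ≤ C ∧ ∀ ξ, ‖u.fourier ξ‖ ≤ C * (1 + ‖ξ‖) ^ M := by
  obtain ⟨K, hK, N, C, hC, h⟩ := u.continuous_toLin
  refine ⟨C, N, hC, fun ξ => h _ _ (by positivity) fun n hn x _ => ?_⟩
  calc _ ≤ ‖ξ‖ ^ n := norm_iteratedFDeriv_osc_le ξ x n
    _ ≤ (1 + ‖ξ‖) ^ n := by gcongr; linarith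
    _ ≤ (1 + ‖ξ‖) ^ N := pow_le_pow_right₀ (by linarith [norm_nonneg ξ]) hn

theorem continuous_jet_osc (K : Set V) [CompactSpace K] (N : ℕ) :
    Continuous fun ξ : V => jet K N (osc ξ) := by
  refine continuous_pi fun n => ContinuousMap.continuous_of_continuous_uncurry _ ?_
  exact (continuous_iteratedFDeriv_osc (V := V) n).comp
    (continuous_fst.prodMk (continuous_subtype_val.comp continuous_snd))

theorem fourier_eq_integral_osc [MeasurableSpace V] [BorelSpace V] [FiniteDimensional ℝ V]
    (a : V → ℂ) (x : V) :
    𝓕 a x = ∫ η, a η * (osc ((2 * Real.pi) • η)).1 x := by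
  rw [Real.fourier_eq']
  refine integral_congr_ae (Eventually.of_forall fun η => ?_)
  simp only [smul_eq_mul]
  rw [mul_comm, osc_apply, inner_smul_right, real_inner_comm]
  congr 2
  push_cast
  ring

theorem iteratedFDeriv_fourier_eq_integral [MeasurableSpace V] [BorelSpace V]
    [FiniteDimensional ℝ V] {a : V → ℂ} (ha : AEStronglyMeasurable a)
    (hi : ∀ n : ℕ, Integrable fun η => ‖η‖ ^ n * ‖a η‖) (n : ℕ) (A : V → ℂ) (hA : A = 𝓕 a)
    (x : V) :
    iteratedFDeriv ℝ n A x =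
      ∫ η, a η • iteratedFDeriv ℝ n (osc ((2 * Real.pi) • η)).1 x := by
  rw [hA, Real.iteratedFDeriv_fourier (N := ⊤) (fun n _ => hi n) ha le_top, Real.fourier_eq']
  refine integral_congr_ae (Eventually.of_forall fun η => ?_)
  ext v
  have h1 : ∀ y : V, (innerSL ℝ η) y = inner ℝ η y := fun y => rfl
  simp only [_root_.smul_apply, iteratedFDeriv_osc_apply,
    VectorFourier.fourierPowSMulRight_apply, inner_smul_left, osc_apply, inner_smul_right,
    h1, smul_eq_mul, Complex.real_smul, Complex.ofReal_prod, Complex.ofReal_mul,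
    Finset.prod_mul_distrib, Finset.prod_const, Finset.card_univ, Fintype.card_fin,
    real_inner_comm x η, conj_trivial]
  have h2 : ((-2 : ℝ) : ℂ) * Real.pi * (inner ℝ x η : ℝ) * Complex.I =
      -Complex.I * (((2 : ℝ) : ℂ) * Real.pi * (inner ℝ x η : ℝ)) := by push_cast; ring
  have h3 : -(2 * (Real.pi : ℂ) * Complex.I) = ((2 : ℝ) : ℂ) * Real.pi * -Complex.I := by
    push_cast; ring
  rw [h2, h3, mul_pow, mul_pow]
  ring

/-- A compactly supported distribution may be applied under the integral sign of a Fourier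
integral. -/
theorem CompactDist.toLin_fourier [MeasurableSpace V] [BorelSpace V] [FiniteDimensional ℝ V]
    (u : CompactDist V) {a : V → ℂ} (ha : AEStronglyMeasurable a)
    (hi : ∀ n : ℕ, Integrable fun η => ‖η‖ ^ n * ‖a η‖)
    (A : Smooth V) (hA : ∀ x, A.1 x = 𝓕 a x) :
    u.toLin A = ∫ η, a η * u.fourier ((2 * Real.pi) • η) := by
  obtain ⟨K, N, hK, ℓ, hℓ⟩ := u.exists_jet_functional
  have hm : ∀ n : Fin (N + 1),
      AEStronglyMeasurable fun η => a η • jet K N (osc ((2 * Real.pi) • η)) n := fun n =>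
    ha.smul (((continuous_apply n).comp
      ((continuous_jet_osc K N).comp (continuous_const_smul (2 * Real.pi)))).aestronglyMeasurable)
  have hint : ∀ n : Fin (N + 1),
      Integrable fun η => a η • jet K N (osc ((2 * Real.pi) • η)) n := fun n => by
    refine (((hi n).const_mul ((2 * Real.pi) ^ (n : ℕ)))).mono' (hm n)
      (Eventually.of_forall fun η => ?_)
    rw [norm_smul, mul_comm, ← mul_assoc]
    gcongr
    rw [ContinuousMap.norm_le _ (by positivity)]
    intro x
    refine (norm_iteratedFDeriv_osc_le _ _ _).trans (le_of_eq ?_)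
    rw [norm_smul, mul_pow, Real.norm_of_nonneg (by positivity)]
  have hint' : Integrable fun η => a η • jet K N (osc ((2 * Real.pi) • η)) :=
    Integrable.of_eval hint
  -- The Fourier integral converges in the Banach space of jets, where evaluations commute with it.
  have hjet : jet K N A = ∫ η, a η • jet K N (osc ((2 * Real.pi) • η)) := by
    funext n
    have h0 := (ContinuousLinearMap.proj (R := ℂ) (φ := fun n : Fin (N + 1) => C(K, MultiForm V n))
      n).integral_comp_comm hint'
    simp only [ContinuousLinearMap.proj_apply, Pi.smul_apply] at h0
    rw [← h0]
    ext1 x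
    rw [ContinuousMap.integral_apply (hint n), jet_apply]
    exact iteratedFDeriv_fourier_eq_integral ha hi n A.1 (funext hA) x
  rw [← hℓ, hjet, ← ContinuousLinearMap.integral_comp_comm ℓ hint']
  refine integral_congr_ae (Eventually.of_forall fun η => ?_)
  simp only [map_smul, hℓ, smul_eq_mul, CompactDist.fourier]

end Fourier

/-! ### Rapid decrease and localization of the Fourier transform -/

section RapidDecrease

variable {V : Type*} [NormedAddCommGroup V]

/-- A function decreases faster than every power of the norm on the set `S`. -/
def RapidlyDecreasingOn (S : Set V) (F : V → ℂ) : Prop :=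
  ∀ N : ℕ, ∃ C : ℝ, ∀ η ∈ S, (1 + ‖η‖) ^ N * ‖F η‖ ≤ C

theorem RapidlyDecreasingOn.mono {S T : Set V} {F : V → ℂ} (h : RapidlyDecreasingOn T F)
    (hST : S ⊆ T) : RapidlyDecreasingOn S F := fun N => by
  obtain ⟨C, hC⟩ := h N
  exact ⟨C, fun η hη => hC η (hST hη)⟩

theorem RapidlyDecreasingOn.union {S T : Set V} {F : V → ℂ} (hS : RapidlyDecreasingOn S F)
    (hT : RapidlyDecreasingOn T F) : RapidlyDecreasingOn (S ∪ T) F := fun N => by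
  obtain ⟨C, hC⟩ := hS N
  obtain ⟨D, hD⟩ := hT N
  exact ⟨max C D, fun η hη => hη.elim (fun h => (hC η h).trans (le_max_left _ _))
    fun h => (hD η h).trans (le_max_right _ _)⟩

theorem RapidlyDecreasingOn.add {S : Set V} {F G : V → ℂ} (hF : RapidlyDecreasingOn S F)
    (hG : RapidlyDecreasingOn S G) : RapidlyDecreasingOn S (fun η => F η + G η) := fun N => by
  obtain ⟨C, hC⟩ := hF N
  obtain ⟨D, hD⟩ := hG N
  refine ⟨C + D, fun η hη => ?_⟩
  calc _ ≤ (1 + ‖η‖) ^ N * (‖F η‖ + ‖G η‖) := by gcongr; exact norm_add_le _ _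
    _ ≤ C + D := by rw [mul_add]; exact add_le_add (hC η hη) (hD η hη)

theorem RapidlyDecreasingOn.const_mul {S : Set V} {F : V → ℂ} (hF : RapidlyDecreasingOn S F)
    (c : ℂ) : RapidlyDecreasingOn S (fun η => c * F η) := fun N => by
  obtain ⟨C, hC⟩ := hF N
  refine ⟨‖c‖ * C, fun η hη => ?_⟩
  rw [norm_mul, mul_left_comm]
  gcongr
  exact hC η hη

theorem RapidlyDecreasingOn.sum {ι : Type*} (s : Finset ι) {S : Set V} {F : ι → V → ℂ}
    (hF : ∀ i ∈ s, RapidlyDecreasingOn S (F i)) :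
    RapidlyDecreasingOn S (fun η => ∑ i ∈ s, F i η) := by
  classical
  induction s using Finset.induction_on with
  | empty => exact fun N => ⟨0, fun η _ => by simp⟩
  | insert i s hi ih =>
    simp only [Finset.sum_insert hi]
    exact (hF i (Finset.mem_insert_self i s)).add
      (ih fun j hj => hF j (Finset.mem_insert_of_mem hj))

theorem rapidlyDecreasingOn_iff {S : Set V} {F : V → ℂ} :
    RapidlyDecreasingOn S F ↔
      ∀ N : ℕ, ∃ C : ℝ, ∀ η ∈ S, ‖F η‖ ≤ C * (1 + ‖η‖) ^ (-(N : ℤ)) := by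
  refine forall_congr' fun N => exists_congr fun C => forall₂_congr fun η _ => ?_
  have h : (0 : ℝ) < (1 + ‖η‖) ^ N := by positivity
  rw [zpow_neg, zpow_natCast, ← div_eq_mul_inv, le_div_iff₀ h, mul_comm]

theorem one_add_norm_le_mul (a b : V) : 1 + ‖a‖ ≤ (1 + ‖a + b‖) * (1 + ‖b‖) := by
  have h : ‖a‖ ≤ ‖a + b‖ + ‖b‖ := by
    simpa using norm_sub_le (a + b) b
  nlinarith [norm_nonneg (a + b), norm_nonneg b,
    mul_nonneg (norm_nonneg (a + b)) (norm_nonneg b)]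

theorem one_add_norm_add_le_mul (a b : V) : 1 + ‖a + b‖ ≤ (1 + ‖a‖) * (1 + ‖b‖) := by
  nlinarith [norm_add_le a b, mul_nonneg (norm_nonneg a) (norm_nonneg b)]

end RapidDecrease

theorem integrable_one_add_pow_mul {X : Type*} [MeasurableSpace X] {μ : Measure X} {s b : X → ℝ}
    (h : ∀ n : ℕ, Integrable (fun x => s x ^ n * b x) μ) (c : ℝ) (P : ℕ) :
    Integrable (fun x => (1 + c * s x) ^ P * b x) μ := by
  have : (fun x => (1 + c * s x) ^ P * b x) = fun x => ∑ k ∈ Finset.range (P + 1),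
      (c ^ k * P.choose k) * (s x ^ k * b x) := by
    funext x
    rw [add_comm, add_pow, Finset.sum_mul]
    refine Finset.sum_congr rfl fun k _ => ?_
    rw [mul_pow, one_pow]
    ring
  rw [this]
  exact integrable_finsetSum _ fun k _ => (h k).const_mul _

section Localization

variable {V : Type*} [NormedAddCommGroup V] [InnerProductSpace ℝ V] [MeasurableSpace V]
  [BorelSpace V] [FiniteDimensional ℝ V]

/-- The Fourier transform of a product with a test function is a convolution. -/
theorem CompactDist.exists_fourier_mul_eq (χ : Smooth V) (hχ : HasCompactSupport χ.1) :
    ∃ a : V → ℂ, (∀ n : ℕ, Integrable fun η => ‖η‖ ^ n * ‖a η‖) ∧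
      ∀ (u : CompactDist V) (ξ : V),
        (u.mul χ).fourier ξ = ∫ η, a η * u.fourier (ξ + (2 * Real.pi) • η) := by
  let X : 𝓢(V, ℂ) := hχ.toSchwartzMap (smooth_contDiff χ)
  let Y : 𝓢(V, ℂ) := 𝓕⁻ X
  refine ⟨Y, fun n => Y.integrable_pow_mul volume n, fun u ξ => ?_⟩
  -- Pair `e^{-i x·ξ} u` with `χ`, written as the Fourier transform of the Schwartz function `Y`.
  have h1 : (u.mul χ).fourier ξ = (u.mul (osc ξ)).toLin χ := by
    rw [CompactDist.fourier, CompactDist.mul_toLin, CompactDist.mul_toLin]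
    congr 1
    exact Subtype.ext (funext fun x => mul_comm _ _)
  have h2 : ∀ x, χ.1 x = 𝓕 (Y : V → ℂ) x := fun x => by
    have h3 : 𝓕 Y = X := FourierTransform.fourier_fourierInv_eq X
    rw [← SchwartzMap.fourier_coe, h3]
    rfl
  rw [h1, CompactDist.toLin_fourier _ Y.continuous.aestronglyMeasurable
    (fun n => Y.integrable_pow_mul volume n) χ h2]
  refine integral_congr_ae (Eventually.of_forall fun η => ?_)
  dsimp only
  rw [CompactDist.fourier, CompactDist.fourier, CompactDist.mul_toLin]
  congr 2
  exact Subtype.ext (funext fun x => (osc_add _ _ x).symm)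

/-- Multiplication by a test function preserves rapid decrease of the Fourier transform in the
directions interior to a cone: the convolution with a rapidly decreasing function is split into a
part inside the cone and a part where the convolution variable is comparable to the frequency. -/
theorem CompactDist.rapidlyDecreasingOn_mul (u : CompactDist V) {Γ : Set V} (hΓ : IsOpen Γ)
    (hcone : ∀ η ∈ Γ, ∀ t : ℝ, 0 < t → t • η ∈ Γ) (hu : RapidlyDecreasingOn Γ u.fourier)
    {w : V} (hw : w ∈ Γ) (χ : Smooth V) (hχ : HasCompactSupport χ.1) :
    RapidlyDecreasingOn {η | ∃ t : ℝ, 0 < t ∧ η = t • w} (u.mul χ).fourier := by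
  obtain ⟨a, hai, ha⟩ := exists_fourier_mul_eq χ hχ
  obtain ⟨C, M, hC, hCM⟩ := u.exists_norm_fourier_le
  obtain ⟨δ, hδ, hball⟩ := Metric.isOpen_iff.1 hΓ w hw
  intro N
  obtain ⟨B, hB⟩ := hu N
  set D : ℝ := 1 + ‖w‖ / δ with hD
  have hD0 : 0 ≤ D := by positivity
  have hD1 : 1 ≤ D := by rw [hD]; linarith [show 0 ≤ ‖w‖ / δ by positivity]
  have key : ∀ t : ℝ, 0 < t → ∀ b : V, (1 + ‖t • w‖) ^ N * ‖u.fourier (t • w + b)‖ ≤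
      (|B| + C * D ^ (N + M)) * (1 + ‖b‖) ^ (N + 2 * M) := by
    intro t ht b
    have hb1 : 1 ≤ 1 + ‖b‖ := by linarith [norm_nonneg b]
    by_cases hb : ‖b‖ < δ * t
    -- `t w + b` is still in the cone, where the Fourier transform decreases.
    · have hmem : t • w + b ∈ Γ := by
        have h1 : t • w + b = t • (w + t⁻¹ • b) := by
          rw [smul_add, smul_inv_smul₀ ht.ne']
        rw [h1]
        refine hcone _ (hball ?_) t ht
        rw [mem_ball_iff_norm, add_sub_cancel_left, norm_smul, norm_inv,
          Real.norm_of_nonneg ht.le, inv_mul_lt_iff₀ ht, mul_comm]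
        exact hb
      calc (1 + ‖t • w‖) ^ N * ‖u.fourier (t • w + b)‖
          ≤ ((1 + ‖t • w + b‖) * (1 + ‖b‖)) ^ N * ‖u.fourier (t • w + b)‖ := by
            gcongr; exact one_add_norm_le_mul _ _
        _ = ((1 + ‖t • w + b‖) ^ N * ‖u.fourier (t • w + b)‖) * (1 + ‖b‖) ^ N := by
            rw [mul_pow]; ring
        _ ≤ |B| * (1 + ‖b‖) ^ (N + 2 * M) :=
            mul_le_mul ((hB _ hmem).trans (le_abs_self B))
              (pow_le_pow_right₀ hb1 (by omega)) (by positivity) (by positivity)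
        _ ≤ _ := by gcongr; exact le_add_of_nonneg_right (by positivity)
    -- `t w` is bounded by a multiple of `b`, and polynomial growth is enough.
    · have h1 : 1 + ‖t • w‖ ≤ D * (1 + ‖b‖) := by
        rw [norm_smul, Real.norm_of_nonneg ht.le]
        have h2 : t ≤ ‖b‖ / δ := by
          rw [le_div_iff₀ hδ, mul_comm]; exact not_lt.1 hb
        have h3 : t * ‖w‖ ≤ ‖w‖ / δ * ‖b‖ := by
          calc t * ‖w‖ ≤ ‖b‖ / δ * ‖w‖ := by gcongr
            _ = _ := by ring
        rw [hD]
        nlinarith [norm_nonneg b, show 0 ≤ ‖w‖ / δ by positivity]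
      calc (1 + ‖t • w‖) ^ N * ‖u.fourier (t • w + b)‖
          ≤ (1 + ‖t • w‖) ^ N * (C * ((1 + ‖t • w‖) * (1 + ‖b‖)) ^ M) := by
            gcongr
            refine (hCM _).trans ?_
            gcongr
            exact one_add_norm_add_le_mul _ _
        _ = C * (1 + ‖t • w‖) ^ (N + M) * (1 + ‖b‖) ^ M := by rw [mul_pow, pow_add]; ring
        _ ≤ C * (D * (1 + ‖b‖)) ^ (N + M) * (1 + ‖b‖) ^ M := by gcongr
        _ = C * D ^ (N + M) * (1 + ‖b‖) ^ (N + 2 * M) := by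
            rw [mul_pow, two_mul, ← add_assoc, pow_add _ (N + M) M]; ring
        _ ≤ _ := by gcongr; exact le_add_of_nonneg_left (abs_nonneg B)
  refine ⟨∫ η, (|B| + C * D ^ (N + M)) *
    ((1 + (2 * Real.pi) * ‖η‖) ^ (N + 2 * M) * ‖a η‖), ?_⟩
  rintro _ ⟨t, ht, rfl⟩
  have hpos : (0 : ℝ) ≤ (1 + ‖t • w‖) ^ N := by positivity
  rw [ha, ← Real.norm_of_nonneg hpos, ← Complex.norm_real, ← norm_mul, ← integral_const_mul]
  refine norm_integral_le_of_norm_le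
    ((integrable_one_add_pow_mul hai (2 * Real.pi) (N + 2 * M)).const_mul _)
    (Eventually.of_forall fun η => ?_)
  rw [norm_mul, norm_mul, Complex.norm_real, Real.norm_of_nonneg hpos, mul_left_comm]
  have h := key t ht ((2 * Real.pi) • η)
  rw [norm_smul (2 * Real.pi), Real.norm_of_nonneg (by positivity : (0 : ℝ) ≤ 2 * Real.pi)] at h
  calc _ ≤ ‖a η‖ * ((|B| + C * D ^ (N + M)) * (1 + 2 * Real.pi * ‖η‖) ^ (N + 2 * M)) := by gcongr
    _ = _ := by ring

end Localization

/-! ### Smoothness of the Radon transform off the wave front set -/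

theorem localFourier_toDist {V : Type*} [NormedAddCommGroup V] [InnerProductSpace ℝ V]
    (f : CompactDist V) (φ : Test V) (η : V) :
    localFourier f.toDist φ η = (f.mul φ.smooth).fourier η := by
  change f.toLin _ = f.toLin _
  congr 1
  exact Subtype.ext (funext fun x => mul_comm _ _)

/-- A quotient of smooth functions is smooth if the denominator does not vanish on the closed support
of the numerator. -/
theorem contDiff_div_of_tsupport {V : Type*} [NormedAddCommGroup V] [NormedSpace ℝ V]
    {a b : V → ℂ} (ha : ContDiff ℝ ∞ a) (hb : ContDiff ℝ ∞ b)
    (h : ∀ x ∈ tsupport a, b x ≠ 0) : ContDiff ℝ ∞ (fun x => a x / b x) := by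
  refine contDiff_iff_contDiffAt.2 fun x => ?_
  by_cases hx : x ∈ tsupport a
  · simp only [div_eq_mul_inv]
    exact ha.contDiffAt.mul (hb.contDiffAt.inv (h x hx))
  · have h0 : (fun y => a y / b y) =ᶠ[𝓝 x] fun _ => 0 := by
      filter_upwards [notMem_tsupport_iff_eventuallyEq.1 hx] with y hy
      rw [hy, Pi.zero_apply, zero_div]
    exact contDiffAt_const.congr_of_eventuallyEq h0

theorem notMem_WF_iff {V : Type*} [NormedAddCommGroup V] [InnerProductSpace ℝ V] {u : Dist V}
    {x ξ : V} (hξ : ξ ≠ 0) :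
    (x, ξ) ∉ WF u ↔ MicrolocallySmoothAt u x ξ := by
  simp [WF, hξ]

section Microlocal

variable {V : Type*} [NormedAddCommGroup V] [InnerProductSpace ℝ V] [MeasurableSpace V]
  [BorelSpace V] [FiniteDimensional ℝ V]

/-- Near a point where neither `w` nor `-w` is in the wave front set, the Fourier transform of every
sufficiently localized piece of `f` is rapidly decreasing along the line through `w`. -/
theorem exists_cutoff_of_notMem_WF (f : CompactDist V) {x₀ w : V} (hw : w ≠ 0)
    (hp : (x₀, w) ∉ WF f.toDist) (hn : (x₀, -w) ∉ WF f.toDist) :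
    ∃ Φ : Smooth V, Φ.1 x₀ ≠ 0 ∧ ∀ ψ : Smooth V,
      RapidlyDecreasingOn {η | ∃ t : ℝ, η = t • w} (f.mul (Smooth.mul ψ Φ)).fourier := by
  rw [notMem_WF_iff hw] at hp
  rw [notMem_WF_iff (neg_ne_zero.2 hw)] at hn
  obtain ⟨φ, hφ, Γ, hΓ, hwΓ, hcone, hdec⟩ := hp
  obtain ⟨φ', hφ', Γ', hΓ', hwΓ', hcone', hdec'⟩ := hn
  simp only [localFourier_toDist] at hdec hdec'
  rw [← rapidlyDecreasingOn_iff] at hdec hdec'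
  -- The product of the cutoffs for `w` and `-w` serves both half-lines.
  refine ⟨Smooth.mul φ.smooth φ'.smooth, mul_ne_zero hφ hφ', fun ψ => ?_⟩
  have h1 : f.mul (Smooth.mul ψ (Smooth.mul φ.smooth φ'.smooth)) =
      (f.mul φ.smooth).mul (Smooth.mul ψ φ'.smooth) := by
    simp only [CompactDist.mul, CompactDist.mk.injEq]
    ext χ
    refine congrArg f.toLin (Subtype.ext (funext fun x => ?_))
    simp only [Smooth.mul_apply]
    ring
  have h2 : f.mul (Smooth.mul ψ (Smooth.mul φ.smooth φ'.smooth)) =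
      (f.mul φ'.smooth).mul (Smooth.mul ψ φ.smooth) := by
    simp only [CompactDist.mul, CompactDist.mk.injEq]
    ext χ
    refine congrArg f.toLin (Subtype.ext (funext fun x => ?_))
    simp only [Smooth.mul_apply]
    ring
  have d1 := (f.mul φ.smooth).rapidlyDecreasingOn_mul hΓ hcone hdec hwΓ (Smooth.mul ψ φ'.smooth)
    φ'.hasCompactSupport.mul_left
  have d2 := (f.mul φ'.smooth).rapidlyDecreasingOn_mul hΓ' hcone' hdec' hwΓ'
    (Smooth.mul ψ φ.smooth) φ.hasCompactSupport.mul_left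
  rw [← h1] at d1
  rw [← h2] at d2
  have d0 : RapidlyDecreasingOn {0} (f.mul (Smooth.mul ψ (Smooth.mul φ.smooth φ'.smooth))).fourier :=
    fun N => ⟨_, fun η hη => by rw [mem_singleton_iff.1 hη]⟩
  refine ((d1.union d2).union d0).mono ?_
  rintro _ ⟨t, rfl⟩
  rcases lt_trichotomy t 0 with ht | rfl | ht
  · exact Or.inl (Or.inr ⟨-t, neg_pos.2 ht, by simp⟩)
  · exact Or.inr (by simp)
  · exact Or.inl (Or.inl ⟨t, ht, rfl⟩)

end Microlocal

theorem inner_eq_mul_real (a b : ℝ) : (inner ℝ a b : ℝ) = a * b := by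
  simp [mul_comm]

theorem fourier_radon_mul (f : CompactDist Plane) (w : UnitCircle) (χ : Smooth ℝ) (σ : ℝ) :
    ((f.radon w).mul χ).fourier σ =
      (f.mul (Smooth.ridge w χ)).fourier (σ • (w : Plane)) := by
  change f.toLin _ = f.toLin _
  refine congrArg f.toLin (Subtype.ext (funext fun x => ?_))
  change χ.1 _ * (osc σ).1 _ = χ.1 _ * (osc (σ • (w : Plane))).1 x
  rw [osc_apply, osc_apply, inner_eq_mul_real, inner_smul_right, mul_comm σ]

/-- If the wave front set of `f` contains no covector `±w` over the line `x·w = p`, then the Radon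
transform of `f` in the direction `w` is smooth near `p`, in terms of the decrease of Fourier
transforms. -/
theorem exists_rapidlyDecreasingOn_radon_mul (f : CompactDist Plane) (w : UnitCircle) (p : ℝ)
    (h : ∀ x₀ : Plane, inner ℝ x₀ (w : Plane) = p →
      (x₀, (w : Plane)) ∉ WF f.toDist ∧ (x₀, -(w : Plane)) ∉ WF f.toDist) :
    ∃ ε : ℝ, 0 < ε ∧ ∀ χ : Smooth ℝ, (∀ s, ε ≤ |s - p| → χ.1 s = 0) →
      RapidlyDecreasingOn univ ((f.radon w).mul χ).fourier := by
  have hw1 : ‖(w : Plane)‖ = 1 := mem_sphere_zero_iff_norm.1 w.2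
  have hw : (w : Plane) ≠ 0 := norm_ne_zero_iff.1 (by rw [hw1]; exact one_ne_zero)
  obtain ⟨R, hR, hfR⟩ := f.exists_ball
  have hcont : Continuous fun y : Plane => (inner ℝ y (w : Plane) : ℝ) :=
    continuous_id.inner continuous_const
  choose! Φ hΦ0 hΦ using fun (x₀ : Plane) (hx : inner ℝ x₀ (w : Plane) = p) =>
    exists_cutoff_of_notMem_WF f hw (h x₀ hx).1 (h x₀ hx).2
  have hΦc : ∀ x, Continuous (Φ x).1 := fun x => (smooth_contDiff (Φ x)).continuous
  have hKc : IsCompact (Metric.closedBall (0 : Plane) (2 * R) ∩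
      {y | inner ℝ y (w : Plane) = p}) :=
    (isCompact_closedBall _ _).inter_right (isClosed_eq hcont continuous_const)
  -- Finitely many cutoffs cover the part of the line `y·w = p` near the support of `f`. The sum `S` of
  -- their squared moduli has no zeros there, so `|y·w - p|` is at least some `a > 0` on its zeros.
  obtain ⟨T, hTK, hT⟩ := hKc.elim_nhds_subcover (fun x => {y | (Φ x).1 y ≠ 0}) fun x hx =>
    (isOpen_ne_fun (hΦc x) continuous_const).mem_nhds (hΦ0 x hx.2)
  let S : Plane → ℂ := fun y => ∑ x ∈ T, conj ((Φ x).1 y) * (Φ x).1 y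
  have hconj : ∀ x, ContDiff ℝ ∞ (fun y => conj ((Φ x).1 y)) := fun x =>
    Complex.conjCLE.contDiff.comp (smooth_contDiff (Φ x))
  have hS : ContDiff ℝ ∞ S := ContDiff.sum fun x _ => (hconj x).mul (smooth_contDiff (Φ x))
  have hS0 : ∀ y, ∀ x ∈ T, (Φ x).1 y ≠ 0 → S y ≠ 0 := by
    intro y x hx hxy
    have h1 : S y = ((∑ x ∈ T, Complex.normSq ((Φ x).1 y) : ℝ) : ℂ) := by
      simp only [S, Complex.ofReal_sum, Complex.normSq_eq_conj_mul_self]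
    rw [h1, Complex.ofReal_ne_zero]
    exact (Finset.sum_pos' (f := fun x => Complex.normSq ((Φ x).1 y))
      (fun _ _ => Complex.normSq_nonneg _) ⟨x, hx, Complex.normSq_pos.2 hxy⟩).ne'
  have hZ : IsCompact (Metric.closedBall (0 : Plane) (2 * R) ∩ {y | S y = 0}) :=
    (isCompact_closedBall _ _).inter_right (isClosed_eq hS.continuous continuous_const)
  obtain ⟨a, ha, haZ⟩ := hZ.exists_forall_le' (f := fun y => |inner ℝ y (w : Plane) - p|) (a := 0)
    (hcont.sub continuous_const).abs.continuousOn fun y hy => by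
      rw [abs_pos, sub_ne_zero]
      intro hyp
      obtain ⟨x, hx, hxy⟩ := mem_iUnion₂.1 (hT ⟨hy.1, hyp⟩)
      exact hS0 y x hx hxy hy.2
  refine ⟨a / 2, by positivity, fun χ hχ => ?_⟩
  let θ : ContDiffBump (0 : Plane) := ⟨R, 2 * R, hR, by linarith⟩
  let b : Plane → ℂ := fun y => (θ y : ℂ) * χ.1 (inner ℝ y (w : Plane))
  have hb : ContDiff ℝ ∞ b :=
    (Complex.ofRealCLM.contDiff.comp θ.contDiff).mul (smooth_contDiff (Smooth.ridge w χ))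
  have hbsupp : ∀ y ∈ tsupport b, S y ≠ 0 := by
    have hsub : tsupport b ⊆ Metric.closedBall 0 (2 * R) ∩
        {y | |inner ℝ y (w : Plane) - p| ≤ a / 2} := by
      refine closure_minimal (fun y hy => ?_) (Metric.isClosed_closedBall.inter
        (isClosed_le (hcont.sub continuous_const).abs continuous_const))
      have hy1 := left_ne_zero_of_mul (Function.mem_support.1 hy)
      have hy2 := right_ne_zero_of_mul (Function.mem_support.1 hy)
      refine ⟨?_, ?_⟩
      · have : y ∈ Function.support θ := fun h0 => hy1 (by rw [h0, Complex.ofReal_zero])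
        rw [θ.support_eq] at this
        exact Metric.ball_subset_closedBall this
      · by_contra hc
        exact hy2 (hχ _ (not_le.1 hc).le)
    intro y hy hSy
    have h1 := haZ y ⟨(hsub hy).1, hSy⟩
    have h2 := (hsub hy).2
    simp only [mem_ofPred_eq] at h2
    linarith
  -- On the strip that carries `χ (y·w)`, a partition of unity subordinate to the cutoffs.
  let ψ : Plane → Smooth Plane := fun x => ⟨fun y => b y * conj ((Φ x).1 y) / S y,
    contDiff_div_of_tsupport (hb.mul (hconj x)) hS fun y hy =>
      hbsupp y (tsupport_mul_subset_left hy)⟩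
  have hsum : ∀ σ : ℝ, ((f.radon w).mul χ).fourier σ =
      ∑ x ∈ T, (f.mul (Smooth.mul (ψ x) (Φ x))).fourier (σ • (w : Plane)) := by
    intro σ
    rw [fourier_radon_mul]
    simp only [CompactDist.fourier, CompactDist.mul_toLin]
    rw [← map_sum]
    refine hfR _ _ fun y hy => ?_
    rw [AddSubmonoidClass.coe_finsetSum, Finset.sum_apply]
    simp only [Smooth.mul_apply]
    rw [← Finset.sum_mul]
    congr 1
    have h1 : ∑ x ∈ T, (ψ x).1 y * (Φ x).1 y = b y / S y * S y := by
      simp only [S, Finset.mul_sum, ψ]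
      refine Finset.sum_congr rfl fun x _ => ?_
      ring
    have h2 : b y = χ.1 (inner ℝ y (w : Plane)) := by
      have : θ y = 1 := θ.one_of_mem_closedBall (by
        rw [mem_closedBall_zero_iff]; exact hy.le)
      simp [b, this]
    rw [h1]
    change χ.1 (inner ℝ y (w : Plane)) = _
    rw [← h2]
    by_cases hby : b y = 0
    · rw [hby, zero_div, zero_mul]
    · rw [div_mul_cancel₀ _ (hbsupp y (subset_tsupport b hby))]
  have hrap := RapidlyDecreasingOn.sum T fun x hx => hΦ x (hTK x hx).2 (ψ x)
  intro N
  obtain ⟨C, hC⟩ := hrap N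
  refine ⟨C, fun σ _ => ?_⟩
  rw [hsum]
  simpa [norm_smul, hw1] using hC (σ • (w : Plane)) ⟨σ, rfl⟩

/-! ### Distributions that are constant in a direction -/

section DistributionBounds

variable {V : Type*} [NormedAddCommGroup V] [NormedSpace ℝ V]

/-- On test functions supported in a fixed compact set, a distribution is bounded by finitely many
derivatives. -/
theorem Dist.exists_bound (u : Dist V) (K : Compacts V) :
    ∃ (N : ℕ) (C : ℝ), 0 ≤ C ∧ ∀ (φ : Test V) (B : ℝ), (∀ x ∉ K, φ x = 0) → 0 ≤ B →
      (∀ n ≤ N, ∀ x, ‖iteratedFDeriv ℝ n φ x‖ ≤ B) → ‖u φ‖ ≤ C * B := by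
  have hK : (K : Set V) ⊆ (⊤ : Opens V) := fun _ _ => trivial
  let L : ContDiffMapSupportedIn V ℂ ⊤ K →L[ℂ] ℂ := u.comp (TestFunction.ofSupportedInCLM ℂ hK)
  let q : Seminorm ℂ (ContDiffMapSupportedIn V ℂ ⊤ K) := (normSeminorm ℂ ℂ).comp L.toLinearMap
  have hq : Continuous q := continuous_norm.comp L.continuous
  obtain ⟨s, C, -, hC⟩ := Seminorm.bound_of_continuous
    (ContDiffMapSupportedIn.withSeminorms ℂ V ℂ ⊤ K) q hq
  refine ⟨s.sup id, C, C.2, fun φ B hφ hB hn => ?_⟩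
  let φ' : ContDiffMapSupportedIn V ℂ ⊤ K := ⟨φ, φ.contDiff, fun x hx => hφ x hx⟩
  have h1 : q φ' ≤ (C • s.sup (ContDiffMapSupportedIn.seminorm ℂ V ℂ ⊤ K)) φ' := hC φ'
  have h2 : s.sup (ContDiffMapSupportedIn.seminorm ℂ V ℂ ⊤ K) φ' ≤ B := by
    refine Seminorm.finset_sup_apply_le hB fun n hns => ?_
    refine (φ'.seminorm_top_le_iff ℂ hB n).2 fun x _ => ?_
    exact hn n (Finset.le_sup (f := id) hns) x
  exact h1.trans (mul_le_mul_of_nonneg_left h2 C.2)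

/-- The derivative of a test function in the direction `v`. -/
def dirDeriv (v : V) (φ : Test V) : Test V where
  toFun x := fderiv ℝ φ x v
  contDiff' := (φ.contDiff.fderiv_right (m := ∞) (by simp)).clm_apply contDiff_const
  hasCompactSupport' := (φ.hasCompactSupport.fderiv_apply ℝ v)
  tsupport_subset' := fun _ _ => trivial

theorem dirDeriv_apply (v : V) (φ : Test V) (x : V) : dirDeriv v φ x = fderiv ℝ φ x v := rfl

theorem tsupport_dirDeriv_subset (v : V) (φ : Test V) :
    tsupport (dirDeriv v φ) ⊆ tsupport φ := tsupport_fderiv_apply_subset ℝ v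

theorem tsupport_iterate_dirDeriv_subset (v : V) (φ : Test V) (k : ℕ) :
    tsupport ((dirDeriv v)^[k] φ) ⊆ tsupport φ := by
  induction k with
  | zero => exact subset_rfl
  | succ k ih =>
    rw [Function.iterate_succ_apply']
    exact (tsupport_dirDeriv_subset v _).trans ih

theorem Test.hasDerivAt_line (φ : Test V) (a v : V) (t : ℝ) :
    HasDerivAt (fun t : ℝ => φ (a + t • v)) (dirDeriv v φ (a + t • v)) t := by
  have h1 : HasFDerivAt φ (fderiv ℝ φ (a + t • v)) (a + t • v) :=
    (φ.contDiff.differentiable (by simp) _).hasFDerivAt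
  have h2 : HasDerivAt (fun q : ℝ => a + q • v) v t := by
    simpa using ((hasDerivAt_id t).smul_const v).const_add a
  exact h1.comp_hasDerivAt t h2

end DistributionBounds

section LocalFourier

variable {V : Type*} [NormedAddCommGroup V] [InnerProductSpace ℝ V]

theorem modulate_apply (φ : Test V) (ξ x : V) :
    modulate φ ξ x = (osc ξ).1 x * φ x := rfl

theorem dirDeriv_modulate (v : V) (φ : Test V) (ξ : V) :
    dirDeriv v (modulate φ ξ) =
      modulate (dirDeriv v φ) ξ - (Complex.I * (inner ℝ v ξ : ℝ)) • modulate φ ξ := by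
  ext x
  have h1 := (modulate φ ξ).hasDerivAt_line x v 0
  have h2 := φ.hasDerivAt_line x v 0
  have h3 : HasDerivAt (fun t : ℝ => (osc ξ).1 (x + t • v))
      (-Complex.I * (inner ℝ v ξ : ℝ) * (osc ξ).1 x) 0 := by
    have h4 : HasDerivAt (fun t : ℝ => -Complex.I * ((inner ℝ x ξ + t * inner ℝ v ξ : ℝ) : ℂ))
        (-Complex.I * (inner ℝ v ξ : ℝ)) 0 := by
      refine HasDerivAt.const_mul _ (HasDerivAt.ofReal_comp ?_)
      simpa using ((hasDerivAt_id (0 : ℝ)).mul_const (inner ℝ v ξ)).const_add (inner ℝ x ξ)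
    have h5 := h4.cexp
    simp only [zero_mul, add_zero] at h5
    refine (h5.congr_deriv (by rw [osc_apply]; ring)).congr_of_eventuallyEq
      (Eventually.of_forall fun t => ?_)
    simp only [osc_apply, inner_add_left, real_inner_smul_left]
  have h6 := h3.mul h2
  have h7 := h1.unique h6
  simp only [zero_smul, add_zero] at h7
  rw [h7]
  change _ = (osc ξ).1 x * dirDeriv v φ x -
    (Complex.I * (inner ℝ v ξ : ℝ)) * ((osc ξ).1 x * φ x)
  ring

/-- The localized Fourier transform grows at most polynomially, with a degree that depends only on
the support of the cutoff. -/
theorem Dist.exists_norm_localFourier_le (u : Dist V) (K : Compacts V) :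
    ∃ M : ℕ, ∀ φ : Test V, tsupport φ ⊆ K →
      ∃ C : ℝ, 0 ≤ C ∧ ∀ ξ, ‖localFourier u φ ξ‖ ≤ C * (1 + ‖ξ‖) ^ M := by
  obtain ⟨N, C, hC, h⟩ := u.exists_bound K
  refine ⟨N, fun φ hφ => ?_⟩
  have hex : ∀ n, ∃ B, ∀ x, ‖iteratedFDeriv ℝ n φ x‖ ≤ B := fun n =>
    (φ.contDiff.continuous_iteratedFDeriv (by exact_mod_cast le_top)).bounded_above_of_compact_support
      (φ.hasCompactSupport.iteratedFDeriv n)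
  choose B hB using hex
  have hB0 : ∀ n, 0 ≤ B n := fun n => (norm_nonneg _).trans (hB n 0)
  set D := ∑ n ∈ Finset.range (N + 1), B n
  have hD : ∀ n ≤ N, ∀ x, ‖iteratedFDeriv ℝ n φ x‖ ≤ D := fun n hn x =>
    (hB n x).trans (Finset.single_le_sum (f := B) (fun n _ => hB0 n)
      (Finset.mem_range.2 (Nat.lt_succ_of_le hn)))
  have hD0 : 0 ≤ D := Finset.sum_nonneg fun n _ => hB0 n
  refine ⟨C * (2 ^ N * D), by positivity, fun ξ => ?_⟩
  have := h (modulate φ ξ) (2 ^ N * (1 + ‖ξ‖) ^ N * D) (fun x hx => ?_) (by positivity)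
    fun n hn x => norm_iteratedFDeriv_mul_le_of_bounds φ.contDiff (smooth_contDiff (osc ξ)) x
      (fun n hn => ?_) (fun n hn => hD n hn x) n hn
  · exact this.trans (le_of_eq (by ring))
  · rw [modulate_apply, image_eq_zero_of_notMem_tsupport fun hc => hx (hφ hc), mul_zero]
  · calc _ ≤ ‖ξ‖ ^ n := norm_iteratedFDeriv_osc_le ξ x n
      _ ≤ (1 + ‖ξ‖) ^ n := by gcongr; linarith
      _ ≤ (1 + ‖ξ‖) ^ N := pow_le_pow_right₀ (by linarith [norm_nonneg ξ]) hn

theorem localFourier_dirDeriv {u : Dist V} {v : V} (hu : ∀ φ, u (dirDeriv v φ) = 0)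
    (φ : Test V) (ξ : V) :
    localFourier u (dirDeriv v φ) ξ = Complex.I * (inner ℝ v ξ : ℝ) * localFourier u φ ξ := by
  have h := hu (modulate φ ξ)
  rw [dirDeriv_modulate, map_sub, map_smul, sub_eq_zero] at h
  exact h

theorem norm_localFourier_iterate_dirDeriv {u : Dist V} {v : V} (hu : ∀ φ, u (dirDeriv v φ) = 0)
    (φ : Test V) (ξ : V) (k : ℕ) :
    ‖localFourier u ((dirDeriv v)^[k] φ) ξ‖ = |inner ℝ v ξ| ^ k * ‖localFourier u φ ξ‖ := by
  induction k with
  | zero => simp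
  | succ k ih =>
    rw [Function.iterate_succ_apply', localFourier_dirDeriv hu, norm_mul, norm_mul, ih,
      Complex.norm_I, Complex.norm_real, Real.norm_eq_abs]
    ring

/-- A distribution that is constant in the direction `v` is microlocally smooth at the covectors that
are not orthogonal to `v`, by integration by parts. -/
theorem rapidlyDecreasingOn_localFourier_of_dirDeriv {u : Dist V} {v : V}
    (hu : ∀ φ, u (dirDeriv v φ) = 0) (φ : Test V) {c : ℝ} (hc : 0 < c) :
    RapidlyDecreasingOn {η : V | c * ‖η‖ < |inner ℝ v η|} (localFourier u φ) := by
  obtain ⟨M, hM⟩ := u.exists_norm_localFourier_le ⟨tsupport φ, φ.hasCompactSupport⟩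
  intro N
  obtain ⟨C, hC, hC1⟩ := hM φ subset_rfl
  obtain ⟨D, hD, hD1⟩ := hM ((dirDeriv v)^[N + M] φ) (tsupport_iterate_dirDeriv_subset v φ _)
  -- `N + M` integrations by parts: `M` of them compensate for the polynomial growth.
  refine ⟨2 ^ (N + M) * (C + (c ^ (N + M))⁻¹ * D), fun η hη => ?_⟩
  have hpos : 0 < (1 + ‖η‖) ^ M := by positivity
  refine le_of_mul_le_mul_right ?_ hpos
  have h1 : (1 + ‖η‖) ^ (N + M) ≤ 2 ^ (N + M) * (1 + ‖η‖ ^ (N + M)) := by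
    have h := add_pow_le zero_le_one (norm_nonneg η) (N + M)
    rw [one_pow] at h
    refine h.trans ?_
    gcongr
    · norm_num
    · omega
  have h2 : ‖η‖ ^ (N + M) ≤ (c ^ (N + M))⁻¹ * |inner ℝ v η| ^ (N + M) := by
    rw [← div_eq_inv_mul, le_div_iff₀ (by positivity), mul_comm, ← mul_pow]
    exact pow_le_pow_left₀ (by positivity) (le_of_lt hη) _
  have h3 := hD1 η
  rw [norm_localFourier_iterate_dirDeriv hu] at h3
  calc (1 + ‖η‖) ^ N * ‖localFourier u φ η‖ * (1 + ‖η‖) ^ M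
      = (1 + ‖η‖) ^ (N + M) * ‖localFourier u φ η‖ := by rw [pow_add]; ring
    _ ≤ 2 ^ (N + M) * (1 + (c ^ (N + M))⁻¹ * |inner ℝ v η| ^ (N + M)) * ‖localFourier u φ η‖ := by
        gcongr
        exact h1.trans (by gcongr)
    _ = 2 ^ (N + M) * (‖localFourier u φ η‖ +
        (c ^ (N + M))⁻¹ * (|inner ℝ v η| ^ (N + M) * ‖localFourier u φ η‖)) := by ring
    _ ≤ 2 ^ (N + M) * (C * (1 + ‖η‖) ^ M + (c ^ (N + M))⁻¹ * (D * (1 + ‖η‖) ^ M)) := by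
        gcongr
        exact hC1 η
    _ = _ := by ring

end LocalFourier

theorem Test.integral_dirDeriv_perp (w : UnitCircle) (φ : Test Plane) (p : ℝ) :
    ∫ t : ℝ, dirDeriv (perp w) φ (p • (w : Plane) + t • perp w) = 0 :=
  integral_eq_zero_of_hasDerivAt_of_integrable
    (fun t => φ.hasDerivAt_line (p • (w : Plane)) (perp w) t)
    (integrable_line w (dirDeriv (perp w) φ) p) (integrable_line w φ p)

/-- A plane wave profile is constant in the direction orthogonal to its wave vector. -/
theorem ridge_dirDeriv_perp (w : UnitCircle) (v : Dist ℝ) (φ : Test Plane) :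
    ridge w v (dirDeriv (perp w) φ) = 0 := by
  have h : radonCLM w (dirDeriv (perp w) φ) = 0 := by
    ext p
    exact Test.integral_dirDeriv_perp w φ p
  change v (radonCLM w (dirDeriv (perp w) φ)) = 0
  rw [h, map_zero]

/-! ### Truncated Hilbert transforms as Fourier multipliers -/

section PlaneWavesOnLine

theorem osc_real_apply (ξ x : ℝ) : (osc ξ).1 x = Complex.exp (-Complex.I * (x * ξ : ℝ)) := by
  rw [osc_apply, inner_eq_mul_real]

theorem osc_add_right (ξ x y : ℝ) : (osc ξ).1 (x + y) = (osc ξ).1 x * (osc ξ).1 y := by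
  simp only [osc_real_apply, ← Complex.exp_add]
  push_cast
  ring_nf

theorem norm_osc_neg_sub_le (ξ t : ℝ) :
    ‖(osc ξ).1 (-t) - (osc ξ).1 t‖ ≤ 2 * |ξ| * |t| := by
  have h : (osc ξ).1 (-t) - (osc ξ).1 t =
      (osc ξ).1 t * (Complex.exp (Complex.I * (2 * ξ * t : ℝ)) - 1) := by
    rw [mul_sub, mul_one, osc_real_apply, osc_real_apply, ← Complex.exp_add]
    congr 2
    push_cast
    ring
  rw [h, norm_mul, norm_osc, one_mul]
  refine Real.norm_exp_I_mul_ofReal_sub_one_le.trans (le_of_eq ?_)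
  rw [Real.norm_eq_abs, abs_mul, abs_mul, abs_two]

theorem measurable_osc : Measurable fun q : ℝ × ℝ => (osc q.1).1 q.2 := by
  simp only [osc_real_apply]
  fun_prop

theorem CompactDist.fourier_deriv (g : CompactDist ℝ) (ξ : ℝ) :
    g.deriv.fourier ξ = Complex.I * ξ * g.fourier ξ := by
  change -g.toLin _ = Complex.I * ξ * g.toLin (osc ξ)
  rw [neg_eq_iff_eq_neg, ← neg_mul, ← smul_eq_mul, ← map_smul]
  refine congrArg g.toLin (Subtype.ext (funext fun x => ?_))
  change _root_.deriv (osc ξ).1 x = -(Complex.I * ξ) * (osc ξ).1 x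
  have h1 : HasDerivAt (fun x : ℝ => -Complex.I * ((x * ξ : ℝ) : ℂ)) (-Complex.I * ξ) x := by
    refine HasDerivAt.const_mul _ (HasDerivAt.ofReal_comp ?_)
    simpa using (hasDerivAt_id x).mul_const ξ
  have h2 : (osc ξ).1 = fun x : ℝ => Complex.exp (-Complex.I * ((x * ξ : ℝ) : ℂ)) :=
    funext (osc_real_apply ξ)
  rw [h2, h1.cexp.deriv]
  ring

end PlaneWavesOnLine

section TruncatedHilbert

/-- The Hilbert transform with kernel `1 / (π t)` multiplied by the even cutoff `b`. -/
def truncHilbert (b : ℝ → ℝ) (h : ℝ → ℂ) (s : ℝ) : ℂ :=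
  (1 / Real.pi : ℂ) * ∫ t in Ioi (0 : ℝ), (h (s - t) - h (s + t)) / (t : ℂ) * b t

/-- The Fourier multiplier of `truncHilbert b`, in the variable dual to `x` under
`e^{-2 π i x σ}`. -/
def hilbertSymbol (b : ℝ → ℝ) (σ : ℝ) : ℂ :=
  (1 / Real.pi : ℂ) * ∫ t in Ioi (0 : ℝ),
    ((osc (2 * Real.pi * σ)).1 (-t) - (osc (2 * Real.pi * σ)).1 t) / (t : ℂ) * b t

theorem norm_hilbertSymbol_integrand_le (b : ℝ → ℝ) (σ t : ℝ) :
    ‖((osc (2 * Real.pi * σ)).1 (-t) - (osc (2 * Real.pi * σ)).1 t) / (t : ℂ) * b t‖ ≤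
      4 * Real.pi * |σ| * |b t| := by
  rw [norm_mul, Complex.norm_real, Real.norm_eq_abs, norm_div, Complex.norm_real,
    Real.norm_eq_abs]
  gcongr
  refine div_le_of_le_mul₀ (abs_nonneg t) (by positivity) ?_
  refine (norm_osc_neg_sub_le _ _).trans (le_of_eq ?_)
  rw [abs_mul, abs_mul, abs_two, abs_of_pos Real.pi_pos]
  ring

theorem measurable_hilbertSymbol_integrand {b : ℝ → ℝ} (hb : Continuous b) :
    Measurable fun q : ℝ × ℝ => ((osc (2 * Real.pi * q.1)).1 (-q.2) -
      (osc (2 * Real.pi * q.1)).1 q.2) / (q.2 : ℂ) * b q.2 := by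
  have h1 := measurable_osc.comp (f := fun q : ℝ × ℝ => (2 * Real.pi * q.1, -q.2)) (by fun_prop)
  have h2 := measurable_osc.comp (f := fun q : ℝ × ℝ => (2 * Real.pi * q.1, q.2)) (by fun_prop)
  have h3 : Measurable fun q : ℝ × ℝ => (b q.2 : ℂ) :=
    Complex.measurable_ofReal.comp (hb.measurable.comp measurable_snd)
  exact ((h1.sub h2).div (by fun_prop)).mul h3

theorem stronglyMeasurable_hilbertSymbol {b : ℝ → ℝ} (hb : Continuous b) :
    StronglyMeasurable (hilbertSymbol b) :=
  ((measurable_hilbertSymbol_integrand hb).stronglyMeasurable.integral_prod_right').const_mul _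

theorem exists_norm_hilbertSymbol_le {b : ℝ → ℝ} (hb : Continuous b) (hc : HasCompactSupport b) :
    ∃ C : ℝ, 0 ≤ C ∧ ∀ σ, ‖hilbertSymbol b σ‖ ≤ C * |σ| := by
  have hbi : Integrable (fun t => |b t|) (volume.restrict (Ioi 0)) :=
    (hb.integrable_of_hasCompactSupport hc).abs.restrict
  refine ⟨‖(1 / Real.pi : ℂ)‖ * (4 * Real.pi * ∫ t in Ioi (0 : ℝ), |b t|), ?_, fun σ => ?_⟩
  · have : 0 ≤ ∫ t in Ioi (0 : ℝ), |b t| := integral_nonneg fun t => abs_nonneg _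
    positivity
  · rw [hilbertSymbol, norm_mul, mul_assoc ‖(1 / Real.pi : ℂ)‖]
    refine mul_le_mul_of_nonneg_left ?_ (norm_nonneg (1 / Real.pi : ℂ))
    refine (norm_integral_le_of_norm_le (hbi.const_mul (4 * Real.pi * |σ|))
      (Eventually.of_forall fun t => norm_hilbertSymbol_integrand_le b σ t)).trans (le_of_eq ?_)
    rw [integral_const_mul]
    ring

/-- A test function as a Schwartz function. -/
def Test.schwartz {V : Type*} [NormedAddCommGroup V] [InnerProductSpace ℝ V] (h : Test V) :
    𝓢(V, ℂ) := h.hasCompactSupport.toSchwartzMap h.contDiff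

/-- The inverse Fourier transform of a test function on the line. -/
def invFourier (h : Test ℝ) : 𝓢(ℝ, ℂ) := 𝓕⁻ h.schwartz

theorem invFourier_apply (h : Test ℝ) (σ : ℝ) : invFourier h σ = 𝓕 (h : ℝ → ℂ) (-σ) := by
  rw [invFourier, SchwartzMap.fourierInv_coe, Real.fourierInv_eq_fourier_neg]
  rfl

theorem Test.eq_integral_invFourier (h : Test ℝ) (s : ℝ) :
    h s = ∫ σ, invFourier h σ * (osc (2 * Real.pi * σ)).1 s := by
  have h1 : 𝓕 (invFourier h) = h.schwartz := FourierTransform.fourier_fourierInv_eq h.schwartz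
  have h2 : h s = 𝓕 (invFourier h : ℝ → ℂ) s := by
    rw [← SchwartzMap.fourier_coe, h1]
    rfl
  rw [h2, fourier_eq_integral_osc]
  rfl

theorem integrable_pow_mul_hilbertSymbol (h : Test ℝ) {b : ℝ → ℝ} (hb : Continuous b)
    (hc : HasCompactSupport b) (n : ℕ) :
    Integrable fun σ : ℝ => ‖σ‖ ^ n * ‖invFourier h σ * hilbertSymbol b σ‖ := by
  obtain ⟨C, hC, hCσ⟩ := exists_norm_hilbertSymbol_le hb hc
  refine (((invFourier h).integrable_pow_mul volume (n + 1)).const_mul C).mono' ?_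
    (Eventually.of_forall fun σ => ?_)
  · exact ((continuous_norm.pow n).aestronglyMeasurable).mul
      ((invFourier h).continuous.aestronglyMeasurable.mul
        (stronglyMeasurable_hilbertSymbol hb).aestronglyMeasurable).norm
  · rw [norm_mul, norm_pow, norm_norm, norm_norm, norm_mul]
    calc ‖σ‖ ^ n * (‖invFourier h σ‖ * ‖hilbertSymbol b σ‖)
        ≤ ‖σ‖ ^ n * (‖invFourier h σ‖ * (C * |σ|)) := by gcongr; exact hCσ σ
      _ = _ := by rw [pow_succ, Real.norm_eq_abs]; ring

/-- A truncated Hilbert transform is a Fourier multiplier. -/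
theorem truncHilbert_eq_fourier (h : Test ℝ) {b : ℝ → ℝ} (hb : Continuous b)
    (hc : HasCompactSupport b) (s : ℝ) :
    truncHilbert b h s = 𝓕 (fun σ => invFourier h σ * hilbertSymbol b σ) s := by
  set Y := invFourier h with hY
  -- Insert the Fourier inversion formula for `h` and exchange the integrals. The numerator vanishes at
  -- `t = 0` to first order, at the cost of a factor `|σ|`.
  let G : ℝ × ℝ → ℂ := fun q => Y q.1 * (osc (2 * Real.pi * q.1)).1 s *
    (((osc (2 * Real.pi * q.1)).1 (-q.2) - (osc (2 * Real.pi * q.1)).1 q.2) / (q.2 : ℂ) * b q.2)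
  have hYi : Integrable fun σ : ℝ => ‖σ‖ * ‖Y σ‖ := by
    simpa using Y.integrable_pow_mul volume 1
  have hbi : Integrable (fun t => |b t|) (volume.restrict (Ioi 0)) :=
    (hb.integrable_of_hasCompactSupport hc).abs.restrict
  have hGm : Measurable G := by
    have h1 := measurable_osc.comp (f := fun q : ℝ × ℝ => (2 * Real.pi * q.1, s)) (by fun_prop)
    exact ((Y.continuous.measurable.comp measurable_fst).mul h1).mul
      (measurable_hilbertSymbol_integrand hb)
  have hG : Integrable G (volume.prod (volume.restrict (Ioi 0))) := by
    refine ((hYi.mul_prod hbi).const_mul (4 * Real.pi)).mono' hGm.aestronglyMeasurable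
      (Eventually.of_forall fun q => ?_)
    rw [norm_mul, norm_mul, norm_osc, mul_one]
    calc _ ≤ ‖Y q.1‖ * (4 * Real.pi * |q.1| * |b q.2|) := by
          gcongr; exact norm_hilbertSymbol_integrand_le b _ _
      _ = _ := by rw [Real.norm_eq_abs]; ring
  have hYosc : ∀ y, Integrable fun σ => Y σ * (osc (2 * Real.pi * σ)).1 y := fun y => by
    refine Y.integrable.norm.mono' ?_ (Eventually.of_forall fun σ => ?_)
    · have h1 := measurable_osc.comp (f := fun σ : ℝ => (2 * Real.pi * σ, y)) (by fun_prop)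
      exact (Y.continuous.measurable.mul h1).aestronglyMeasurable
    · rw [norm_mul, norm_osc, mul_one]
  have h1 : ∀ t : ℝ, (h (s - t) - h (s + t)) / (t : ℂ) * b t = ∫ σ, G (σ, t) := by
    intro t
    rw [h.eq_integral_invFourier, h.eq_integral_invFourier (s + t), ← hY,
      ← integral_sub (hYosc _) (hYosc _), ← integral_div, ← integral_mul_const]
    refine integral_congr_ae (Eventually.of_forall fun σ => ?_)
    simp only [G, sub_eq_add_neg s t, osc_add_right]
    ring
  rw [truncHilbert, fourier_eq_integral_osc]
  simp only [h1]
  rw [← integral_integral_swap (f := fun σ t => G (σ, t)) hG, ← integral_const_mul]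
  refine integral_congr_ae (Eventually.of_forall fun σ => ?_)
  simp only [G, hilbertSymbol]
  rw [integral_const_mul, smul_eq_mul]
  ring

/-- The truncated Hilbert transform of a test function, as a smooth function. -/
def truncHilbertTest (b : ℝ → ℝ) (hb : Continuous b) (hc : HasCompactSupport b) (h : Test ℝ) :
    Smooth ℝ :=
  ⟨truncHilbert b h, by
    rw [show truncHilbert b h = _ from funext (truncHilbert_eq_fourier h hb hc)]
    exact Real.contDiff_fourier (N := ⊤) fun n _ => integrable_pow_mul_hilbertSymbol h hb hc n⟩

theorem CompactDist.toLin_truncHilbertTest (W : CompactDist ℝ) {b : ℝ → ℝ} (hb : Continuous b)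
    (hc : HasCompactSupport b) (h : Test ℝ) :
    W.toLin (truncHilbertTest b hb hc h) =
      ∫ σ, invFourier h σ * (hilbertSymbol b σ * W.fourier (2 * Real.pi * σ)) := by
  rw [W.toLin_fourier ((invFourier h).continuous.aestronglyMeasurable.mul
    (stronglyMeasurable_hilbertSymbol hb).aestronglyMeasurable)
    (integrable_pow_mul_hilbertSymbol h hb hc) _ (truncHilbert_eq_fourier h hb hc)]
  refine integral_congr_ae (Eventually.of_forall fun σ => ?_)
  simp only [smul_eq_mul, Pi.mul_apply]
  ring

/-- Away from the singularity of its kernel, the truncated Hilbert transform is convolution with a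
test function, so that its multiplier is rapidly decreasing. -/
theorem rapidlyDecreasingOn_hilbertSymbol {b : ℝ → ℝ} (hb : ContDiff ℝ ∞ b)
    (hc : HasCompactSupport b) (heven : ∀ t, b (-t) = b t) (h0 : (0 : ℝ) ∉ tsupport b) :
    RapidlyDecreasingOn univ (hilbertSymbol b) := by
  let k : ℝ → ℂ := fun t => (b t : ℂ) / (t : ℂ)
  have hcC : HasCompactSupport fun t => (b t : ℂ) := hc.comp_left Complex.ofReal_zero
  have hk : ContDiff ℝ ∞ k := by
    refine contDiff_div_of_tsupport (Complex.ofRealCLM.contDiff.comp hb)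
      Complex.ofRealCLM.contDiff fun t ht => ?_
    have hsub : tsupport (fun t => (b t : ℂ)) ⊆ tsupport b :=
      closure_mono fun t ht ht' => ht (by simp [ht'])
    rw [Complex.ofReal_ne_zero]
    rintro rfl
    exact h0 (hsub ht)
  have hkc : HasCompactSupport k := by
    have : k = fun t => (b t : ℂ) * ((t : ℂ))⁻¹ := funext fun t => div_eq_mul_inv _ _
    rw [this]
    exact hcC.mul_right
  let X : 𝓢(ℝ, ℂ) := hkc.toSchwartzMap hk
  let Y : 𝓢(ℝ, ℂ) := 𝓕 X
  have hosc : ∀ σ, Integrable fun t => k t * (osc (2 * Real.pi * σ)).1 t := fun σ =>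
    (hk.continuous.mul (smooth_contDiff (osc (2 * Real.pi * σ))).continuous).integrable_of_hasCompactSupport
      hkc.mul_right
  -- `k` is odd, so that the integral over the half-line is a Fourier integral over the line.
  have hY : ∀ σ, hilbertSymbol b σ = -(1 / Real.pi : ℂ) * Y σ := by
    intro σ
    have h1 : Y σ = ∫ t, k t * (osc (2 * Real.pi * σ)).1 t := by
      change (𝓕 X) σ = _
      rw [SchwartzMap.fourier_coe, fourier_eq_integral_osc]
      refine integral_congr_ae (Eventually.of_forall fun t => ?_)
      change k t * _ = k t * _
      rw [osc_real_apply, osc_real_apply, smul_eq_mul]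
      congr 4
      ring
    have h2 : ∫ t in Iic (0 : ℝ), k t * (osc (2 * Real.pi * σ)).1 t =
        ∫ t in Ioi (0 : ℝ), -(k t * (osc (2 * Real.pi * σ)).1 (-t)) := by
      have h3 := integral_comp_neg_Ioi (0 : ℝ) (fun t => k t * (osc (2 * Real.pi * σ)).1 t)
      rw [neg_zero] at h3
      rw [← h3]
      refine integral_congr_ae (Eventually.of_forall fun t => ?_)
      simp only [k, heven, Complex.ofReal_neg, div_neg]
      ring
    have h4 : Integrable (fun t => -(k t * (osc (2 * Real.pi * σ)).1 (-t)))
        (volume.restrict (Ioi 0)) := by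
      refine Integrable.restrict (Continuous.integrable_of_hasCompactSupport ?_ ?_).neg
      · exact hk.continuous.mul
          ((smooth_contDiff (osc (2 * Real.pi * σ))).continuous.comp continuous_neg)
      · exact hkc.mul_right
    rw [h1, ← integral_add_compl (measurableSet_Ioi (a := (0 : ℝ))) (hosc σ), compl_Ioi, h2,
      ← integral_add (hosc σ).restrict h4, hilbertSymbol, neg_mul, ← mul_neg, ← integral_neg]
    congr 1
    refine integral_congr_ae (Eventually.of_forall fun t => ?_)
    simp only [k]
    ring
  intro N
  refine ⟨‖-(1 / Real.pi : ℂ)‖ * (2 ^ N *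
    (Finset.Iic (N, 0)).sup (fun m => SchwartzMap.seminorm ℝ m.1 m.2) Y), fun σ _ => ?_⟩
  have h5 := SchwartzMap.one_add_le_sup_seminorm_apply (𝕜 := ℝ) (m := (N, 0)) le_rfl le_rfl Y σ
  rw [norm_iteratedFDeriv_zero] at h5
  rw [hY, norm_mul, mul_left_comm]
  gcongr

end TruncatedHilbert

/-! ### Radon transforms of modulated test functions -/

section RadonOfPlaneWaves

theorem invFourier_eq_integral (h : Test ℝ) (σ : ℝ) :
    invFourier h σ = ∫ x, h x * (osc (2 * Real.pi * x)).1 (-σ) := by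
  rw [invFourier_apply, fourier_eq_integral_osc]
  rfl

theorem integrable_mul_osc (h : Test ℝ) (σ : ℝ) :
    Integrable fun x => h x * (osc (2 * Real.pi * x)).1 (-σ) := by
  have h1 := measurable_osc.comp (f := fun x : ℝ => (2 * Real.pi * x, -σ)) (by fun_prop)
  have h2 : Integrable h := h.continuous.integrable_of_hasCompactSupport h.hasCompactSupport
  refine h2.norm.mono' (h.continuous.measurable.mul h1).aestronglyMeasurable
    (Eventually.of_forall fun x => ?_)
  rw [norm_mul, norm_osc, mul_one]

theorem invFourier_add (h k : Test ℝ) (σ : ℝ) :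
    invFourier (h + k) σ = invFourier h σ + invFourier k σ := by
  simp only [invFourier_eq_integral]
  rw [← integral_add (integrable_mul_osc h σ) (integrable_mul_osc k σ)]
  exact integral_congr_ae (Eventually.of_forall fun x => add_mul (h x) (k x) _)

theorem invFourier_smul (c : ℂ) (h : Test ℝ) (σ : ℝ) :
    invFourier (c • h) σ = c * invFourier h σ := by
  simp only [invFourier_eq_integral]
  rw [← integral_const_mul]
  exact integral_congr_ae (Eventually.of_forall fun x => mul_assoc c (h x) _)

theorem dirDeriv_one (h : Test ℝ) : (dirDeriv (1 : ℝ) h : ℝ → ℂ) = _root_.deriv h := by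
  funext s
  rw [dirDeriv_apply, fderiv_apply_one_eq_deriv]

theorem invFourier_dirDeriv_one (h : Test ℝ) (σ : ℝ) :
    invFourier (dirDeriv (1 : ℝ) h) σ = -(2 * Real.pi * Complex.I * σ) * invFourier h σ := by
  have h1 : Integrable h := h.continuous.integrable_of_hasCompactSupport h.hasCompactSupport
  have h2 : Integrable (_root_.deriv h) := by
    rw [← dirDeriv_one]
    exact (dirDeriv (1 : ℝ) h).continuous.integrable_of_hasCompactSupport
      (dirDeriv (1 : ℝ) h).hasCompactSupport
  rw [invFourier_apply, dirDeriv_one, Real.fourier_deriv h1 (h.contDiff.differentiable (by simp)) h2,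
    invFourier_apply]
  simp

theorem Test.exists_radius_bound {V : Type*} [NormedAddCommGroup V] [NormedSpace ℝ V]
    (φ : Test V) :
    ∃ r B : ℝ, 0 ≤ r ∧ 0 ≤ B ∧ (∀ x, r < ‖x‖ → φ x = 0) ∧ ∀ x, ‖φ x‖ ≤ B := by
  obtain ⟨r, hr⟩ := φ.hasCompactSupport.isBounded.subset_closedBall 0
  obtain ⟨B, hB⟩ := φ.continuous.bounded_above_of_compact_support φ.hasCompactSupport
  refine ⟨|r|, B, abs_nonneg r, (norm_nonneg _).trans (hB 0), fun x hx => ?_, hB⟩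
  by_contra hc
  have := mem_closedBall_zero_iff.1 (hr (subset_tsupport _ hc))
  linarith [le_abs_self r]

/-- Differentiation of the Radon transform with respect to the affine parameter. -/
theorem radonTest_dirDeriv (w : UnitCircle) (χ : Test Plane) :
    radonTest w (dirDeriv (w : Plane) χ) = dirDeriv (1 : ℝ) (radonTest w χ) := by
  let D : ℕ → Test Plane := fun n => (dirDeriv (w : Plane))^[n] χ
  obtain ⟨hit, -⟩ := iteratedDeriv_integral (μ := volume)
    (h := fun n p t => D n (p • (w : Plane) + t • perp w))
    (fun n p t => by
      have h1 := (D n).hasDerivAt_line (t • perp w) (w : Plane) p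
      have h2 : dirDeriv (w : Plane) (D n) = D (n + 1) :=
        (Function.iterate_succ_apply' _ _ _).symm
      rw [h2] at h1
      simp only [add_comm (t • perp w)] at h1
      exact h1)
    (fun n p => (integrable_line w (D n) p).aestronglyMeasurable)
    (fun n R => by
      obtain ⟨r, B, hr, hB, hz, hb⟩ := (D n).exists_radius_bound
      refine ⟨(Icc (-r) r).indicator fun _ => B, (integrable_indicator_iff measurableSet_Icc).2
        (integrableOn_const (by simp)), Eventually.of_forall fun t p _ => ?_⟩
      by_cases ht : t ∈ Icc (-r) r
      · rw [indicator_of_mem ht]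
        exact hb _
      · rw [indicator_of_notMem ht, hz _ ?_, norm_zero]
        have h1 : r < |t| := by
          by_contra hc
          exact ht (abs_le.1 (not_lt.1 hc))
        exact h1.trans_le (abs_le_norm_line w p t).2)
  ext p
  rw [dirDeriv_one, ← iteratedDeriv_one]
  exact (congrFun (hit 1) p).symm

theorem radonTest_dirDeriv_modulate (w : UnitCircle) (φ : Test Plane) (η : Plane) :
    radonTest w (modulate (dirDeriv (w : Plane) φ) η) =
      dirDeriv (1 : ℝ) (radonTest w (modulate φ η)) +
        (Complex.I * (inner ℝ (w : Plane) η : ℝ)) • radonTest w (modulate φ η) := by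
  rw [← radonTest_dirDeriv, dirDeriv_modulate]
  change radonCLM w _ = radonCLM w _ + _ • radonCLM w _
  rw [map_sub, map_smul, sub_add_cancel]

/-- Integration by parts in the Fourier transform of the Radon transform of a modulated test
function. -/
theorem norm_invFourier_radonTest_iterate (w : UnitCircle) (φ : Test Plane) (η : Plane) (σ : ℝ)
    (k : ℕ) :
    ‖invFourier (radonTest w (modulate ((dirDeriv (w : Plane))^[k] φ) η)) σ‖ =
      |inner ℝ (w : Plane) η - 2 * Real.pi * σ| ^ k *
        ‖invFourier (radonTest w (modulate φ η)) σ‖ := by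
  induction k with
  | zero => simp
  | succ k ih =>
    have h1 : -(2 * Real.pi * Complex.I * σ) + Complex.I * (inner ℝ (w : Plane) η : ℝ) =
        Complex.I * ((inner ℝ (w : Plane) η - 2 * Real.pi * σ : ℝ) : ℂ) := by
      push_cast; ring
    rw [Function.iterate_succ_apply', radonTest_dirDeriv_modulate, invFourier_add,
      invFourier_smul, invFourier_dirDeriv_one, ← add_mul, h1, norm_mul, norm_mul, ih,
      Complex.norm_I, Complex.norm_real, Real.norm_eq_abs, pow_succ]
    ring

theorem exists_norm_invFourier_radonTest_le (w : UnitCircle) (φ : Test Plane) :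
    ∃ A : ℝ, 0 ≤ A ∧ ∀ η σ, ‖invFourier (radonTest w (modulate φ η)) σ‖ ≤ A := by
  obtain ⟨r, B, hr, hB, hz, hb⟩ := φ.exists_radius_bound
  have hint : ∀ c : ℝ, Integrable ((Icc (-r) r).indicator fun _ => c) := fun c =>
    (integrable_indicator_iff measurableSet_Icc).2 (integrableOn_const (by simp))
  refine ⟨∫ x, (Icc (-r) r).indicator (fun _ => 2 * |r| * B) x,
    integral_nonneg fun x => indicator_nonneg (fun _ _ => by positivity) x, fun η σ => ?_⟩
  rw [invFourier_eq_integral]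
  refine norm_integral_le_of_norm_le (hint _) (Eventually.of_forall fun s => ?_)
  have hz' : ∀ x, r < ‖x‖ → modulate φ η x = 0 := fun x hx => by
    rw [modulate_apply, hz x hx, mul_zero]
  rw [norm_mul, norm_osc, mul_one]
  by_cases hs : s ∈ Icc (-r) r
  · rw [indicator_of_mem hs]
    have h1 := (radon_deriv (modulate φ η).contDiff hz' w).2 0 B (fun x => ?_) hB s
    · rwa [norm_iteratedFDeriv_zero] at h1
    · rw [norm_iteratedFDeriv_zero, modulate_apply, norm_mul, norm_osc, one_mul]
      exact hb x
  · rw [indicator_of_notMem hs]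
    have h1 : r < |s| := by
      by_contra hc
      exact hs (abs_le.1 (not_lt.1 hc))
    have h2 : radon (modulate φ η) w s = 0 := by
      have : ∀ t : ℝ, modulate φ η (s • (w : Plane) + t • perp w) = 0 := fun t =>
        hz' _ (h1.trans_le (abs_le_norm_line w s t).1)
      simp [radon, this]
    exact (norm_eq_zero.2 h2).le

/-- The Fourier transform of the Radon transform of `e^{-i x·η} φ` is concentrated, uniformly in
`η`, at the frequency `w·η`. -/
theorem exists_concentration_invFourier_radonTest (w : UnitCircle) (φ : Test Plane) (N : ℕ) :
    ∃ A : ℝ, 0 ≤ A ∧ ∀ η σ, (1 + |inner ℝ (w : Plane) η - 2 * Real.pi * σ|) ^ N *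
      ‖invFourier (radonTest w (modulate φ η)) σ‖ ≤ A := by
  obtain ⟨A, hA, hA1⟩ := exists_norm_invFourier_radonTest_le w φ
  obtain ⟨B, hB, hB1⟩ := exists_norm_invFourier_radonTest_le w ((dirDeriv (w : Plane))^[N] φ)
  refine ⟨2 ^ N * (A + B), by positivity, fun η σ => ?_⟩
  set c := |inner ℝ (w : Plane) η - 2 * Real.pi * σ| with hc
  have hc0 : 0 ≤ c := abs_nonneg _
  have h1 : (1 + c) ^ N ≤ 2 ^ N * (1 + c ^ N) := by
    have h := add_pow_le zero_le_one hc0 N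
    rw [one_pow] at h
    refine h.trans ?_
    gcongr
    · norm_num
    · omega
  have h2 := hB1 η σ
  rw [norm_invFourier_radonTest_iterate, ← hc] at h2
  calc _ ≤ 2 ^ N * (1 + c ^ N) * ‖invFourier (radonTest w (modulate φ η)) σ‖ := by gcongr
    _ = 2 ^ N * (‖invFourier (radonTest w (modulate φ η)) σ‖ +
        c ^ N * ‖invFourier (radonTest w (modulate φ η)) σ‖) := by ring
    _ ≤ _ := by
        gcongr
        exact hA1 η σ

/-- If the product of the multiplier and of the Fourier transform of `W` is rapidly decreasing, then
so is the pairing of `W` with the filtered Radon transforms of modulated test functions, in all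
directions that are not orthogonal to `w`. -/
theorem rapidlyDecreasingOn_toLin_truncHilbertTest (W : CompactDist ℝ) {b : ℝ → ℝ}
    (hb : Continuous b) (hc : HasCompactSupport b)
    (hW : RapidlyDecreasingOn univ fun σ : ℝ => hilbertSymbol b σ * W.fourier (2 * Real.pi * σ))
    (w : UnitCircle) (φ : Test Plane) {c : ℝ} (hc0 : 0 < c) :
    RapidlyDecreasingOn {η : Plane | c * ‖η‖ < |inner ℝ (w : Plane) η|}
      fun η => W.toLin (truncHilbertTest b hb hc (radonTest w (modulate φ η))) := by
  intro N
  obtain ⟨A, hA, hA1⟩ := exists_concentration_invFourier_radonTest w φ N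
  -- `N` powers turn decrease in `σ` into decrease in `w·η`, and two make the integral converge.
  obtain ⟨B, hB⟩ := hW (N + 2)
  have hB0 : 0 ≤ B := le_trans (by positivity) (hB 0 (mem_univ _))
  have hbound : ∀ (η : Plane) (σ : ℝ), (1 + |inner ℝ (w : Plane) η|) ^ N *
      ‖invFourier (radonTest w (modulate φ η)) σ *
        (hilbertSymbol b σ * W.fourier (2 * Real.pi * σ))‖ ≤
      A * ((2 * Real.pi) ^ N * B) * (1 + σ ^ 2)⁻¹ := by
    intro η σ
    set x := inner ℝ (w : Plane) η
    set m := ‖hilbertSymbol b σ * W.fourier (2 * Real.pi * σ)‖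
    set F := ‖invFourier (radonTest w (modulate φ η)) σ‖
    have h1 : 1 + |x| ≤ (1 + |x - 2 * Real.pi * σ|) * (2 * Real.pi * (1 + |σ|)) := by
      have h2 := one_add_norm_le_mul x (-(2 * Real.pi * σ))
      rw [norm_neg, ← sub_eq_add_neg, Real.norm_eq_abs, Real.norm_eq_abs, Real.norm_eq_abs,
        abs_mul, abs_of_pos Real.two_pi_pos] at h2
      refine h2.trans ?_
      gcongr
      nlinarith [Real.pi_gt_three]
    have h3 : (1 + |σ|) ^ N * m ≤ B * (1 + σ ^ 2)⁻¹ := by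
      rw [← div_eq_mul_inv, le_div_iff₀ (by positivity)]
      calc (1 + |σ|) ^ N * m * (1 + σ ^ 2) ≤ (1 + |σ|) ^ N * m * (1 + |σ|) ^ 2 := by
            gcongr
            rw [← sq_abs σ]
            nlinarith [abs_nonneg σ]
        _ = (1 + ‖σ‖) ^ (N + 2) * m := by rw [Real.norm_eq_abs, pow_add]; ring
        _ ≤ B := hB σ (mem_univ _)
    rw [norm_mul]
    calc (1 + |x|) ^ N * (F * m)
        ≤ ((1 + |x - 2 * Real.pi * σ|) * (2 * Real.pi * (1 + |σ|))) ^ N * (F * m) := by gcongr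
      _ = ((1 + |x - 2 * Real.pi * σ|) ^ N * F) *
          ((2 * Real.pi) ^ N * ((1 + |σ|) ^ N * m)) := by
          rw [mul_pow, mul_pow]; ring
      _ ≤ A * ((2 * Real.pi) ^ N * (B * (1 + σ ^ 2)⁻¹)) := by
          gcongr
          exact hA1 η σ
      _ = _ := by ring
  refine ⟨(1 + c⁻¹) ^ N * ∫ σ : ℝ, A * ((2 * Real.pi) ^ N * B) * (1 + σ ^ 2)⁻¹, fun η hη => ?_⟩
  have h1 : 1 + ‖η‖ ≤ (1 + c⁻¹) * (1 + |inner ℝ (w : Plane) η|) := by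
    have h2 : ‖η‖ ≤ c⁻¹ * |inner ℝ (w : Plane) η| := by
      rw [← div_eq_inv_mul, le_div_iff₀ hc0, mul_comm]
      exact le_of_lt hη
    have h3 : 0 < c⁻¹ := inv_pos.2 hc0
    nlinarith [abs_nonneg (inner ℝ (w : Plane) η)]
  set x := |inner ℝ (w : Plane) η| with hx
  have hx0 : 0 ≤ x := abs_nonneg _
  have hpos : (0 : ℝ) ≤ (1 + x) ^ N := by positivity
  have h4 : (1 + x) ^ N * ‖W.toLin (truncHilbertTest b hb hc (radonTest w (modulate φ η)))‖ ≤
      ∫ σ : ℝ, A * ((2 * Real.pi) ^ N * B) * (1 + σ ^ 2)⁻¹ := by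
    rw [CompactDist.toLin_truncHilbertTest, ← Real.norm_of_nonneg hpos, ← Complex.norm_real,
      ← norm_mul, ← integral_const_mul]
    refine norm_integral_le_of_norm_le (integrable_inv_one_add_sq.const_mul _)
      (Eventually.of_forall fun σ => ?_)
    rw [norm_mul, Complex.norm_real, Real.norm_of_nonneg hpos]
    exact hbound η σ
  calc _ ≤ ((1 + c⁻¹) * (1 + x)) ^ N *
        ‖W.toLin (truncHilbertTest b hb hc (radonTest w (modulate φ η)))‖ := by gcongr
    _ = (1 + c⁻¹) ^ N * ((1 + x) ^ N *
        ‖W.toLin (truncHilbertTest b hb hc (radonTest w (modulate φ η)))‖) := by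
        rw [mul_pow]; ring
    _ ≤ _ := by gcongr

end RadonOfPlaneWaves

/-! ### Pseudolocality of the filter and the wave front set of the reconstruction -/

section Pseudolocality

theorem exists_norm_ofReal_le_of_hasCompactSupport {b : ℝ → ℝ} (hb : Continuous b)
    (hc : HasCompactSupport b) : ∃ C, ∀ t, ‖(b t : ℂ)‖ ≤ C := by
  obtain ⟨C, hC⟩ := hb.bounded_above_of_compact_support hc
  exact ⟨C, fun t => by rw [Complex.norm_real]; exact hC t⟩

/-- On a bounded set, the Hilbert transform is the sum of its truncations to two cutoffs that add up
to one on a large interval. -/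
theorem hilbertTest_eq_truncHilbert_add (h : Test ℝ) {b₁ b₂ : ℝ → ℝ} (hb₁ : Continuous b₁)
    (hc₁ : HasCompactSupport b₁) (hb₂ : Continuous b₂) (hc₂ : HasCompactSupport b₂) {r R : ℝ}
    (hz : ∀ s, r < |s| → h s = 0) (hsum : ∀ t, 0 < t → t ≤ R + r → b₁ t + b₂ t = 1) {s : ℝ}
    (hs : |s| < R) :
    (hilbertTest h).1 s = truncHilbert b₁ h s + truncHilbert b₂ h s := by
  have hint : ∀ b : ℝ → ℝ, Continuous b → HasCompactSupport b →
      Integrable (fun t : ℝ => (h (s - t) - h (s + t)) / (t : ℂ) * b t)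
        (volume.restrict (Ioi 0)) := by
    intro b hb hc
    obtain ⟨C, hC⟩ := exists_norm_ofReal_le_of_hasCompactSupport hb hc
    exact (integrable_hilbert h s).mul_bdd (c := C)
      (Complex.continuous_ofReal.comp hb).aestronglyMeasurable (Eventually.of_forall hC)
  rw [hilbertTest_apply, truncHilbert, truncHilbert, ← mul_add,
    ← integral_add (hint b₁ hb₁ hc₁) (hint b₂ hb₂ hc₂)]
  congr 1
  refine setIntegral_congr_fun measurableSet_Ioi fun t ht => ?_
  rw [mem_Ioi] at ht
  by_cases htR : t ≤ R + r
  · rw [← mul_add, ← Complex.ofReal_add, hsum t ht htR, Complex.ofReal_one, mul_one]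
  · have hs' := abs_lt.1 hs
    have h1 : h (s - t) = 0 := hz _ (by rw [lt_abs]; right; linarith)
    have h2 : h (s + t) = 0 := hz _ (by rw [lt_abs]; left; linarith)
    simp [h1, h2]

theorem truncHilbert_eq_zero {h : ℝ → ℂ} {b : ℝ → ℝ} {p ρ δ : ℝ}
    (hz : ∀ s, ρ ≤ |s - p| → h s = 0) (hb : ∀ t, δ ≤ |t| → b t = 0) {s : ℝ}
    (hs : ρ + δ ≤ |s - p|) : truncHilbert b h s = 0 := by
  rw [truncHilbert]
  have h0 : ∀ t : ℝ, (h (s - t) - h (s + t)) / (t : ℂ) * b t = 0 := by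
    intro t
    by_cases ht : δ ≤ |t|
    · simp [hb t ht]
    · have ht' := not_le.1 ht
      have h1 := abs_sub_abs_le_abs_sub (s - p) t
      have h2 := abs_sub_abs_le_abs_sub (s - p) (-t)
      rw [abs_neg] at h2
      have h3 : s - t - p = s - p - t := by ring
      have h4 : s + t - p = s - p - -t := by ring
      rw [hz (s - t) (by rw [h3]; linarith), hz (s + t) (by rw [h4]; linarith)]
      simp
  simp only [h0, integral_zero, mul_zero]

/-- Multiplying a distribution by `χ` does not change the pairing of its derivative with a function
that vanishes where `χ` is not one. -/
theorem CompactDist.deriv_toLin_congr (g : CompactDist ℝ) (χ A : Smooth ℝ)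
    (h : ∀ s, χ.1 s = 1 ∨ A.1 =ᶠ[𝓝 s] 0) : (g.mul χ).deriv.toLin A = g.deriv.toLin A := by
  change -g.toLin _ = -g.toLin _
  refine congrArg (fun φ => -g.toLin φ) (Subtype.ext (funext fun s => ?_))
  change χ.1 s * _root_.deriv A.1 s = _root_.deriv A.1 s
  rcases h s with h | h
  · rw [h, one_mul]
  · have : _root_.deriv A.1 s = 0 := by
      rw [h.deriv_eq]
      simp
    rw [this, mul_zero]

theorem radonTest_modulate_eq_zero (w : UnitCircle) {φ : Test Plane} {x : Plane} {ρ : ℝ}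
    (hφ : ∀ y, ρ ≤ ‖y - x‖ → φ y = 0) (η : Plane) {s : ℝ}
    (hs : ρ ≤ |s - inner ℝ x (w : Plane)|) : radonTest w (modulate φ η) s = 0 := by
  have h0 : ∀ t : ℝ, modulate φ η (s • (w : Plane) + t • perp w) = 0 := by
    intro t
    rw [modulate_apply, hφ _ ?_, mul_zero]
    refine hs.trans ?_
    have h1 := abs_real_inner_le_norm (s • (w : Plane) + t • perp w - x) (w : Plane)
    rw [mem_sphere_zero_iff_norm.1 w.2, mul_one] at h1
    refine le_trans (le_of_eq ?_) h1
    congr 1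
    have h2 := unit_sq w
    simp [PiLp.inner_apply, Fin.sum_univ_two, perp]
    linear_combination (-s) * h2
  change radon (modulate φ η) w s = 0
  simp [radon, h0]

/-- If the wave front set of `f` contains no covector `±w` over the line `x·w = p`, then the
backprojected filtered data in the direction `w` are microlocally smooth over that line. The part of
the kernel of the Hilbert transform near its singularity only sees the smooth part of the data, and
the rest of the kernel is smoothing. -/
theorem exists_rapidlyDecreasingOn_ridge_filter (f : CompactDist Plane) (w : UnitCircle) (x : Plane)
    (h : ∀ x₀ : Plane, inner ℝ x₀ (w : Plane) = inner ℝ x (w : Plane) →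
      (x₀, (w : Plane)) ∉ WF f.toDist ∧ (x₀, -(w : Plane)) ∉ WF f.toDist) :
    ∃ ρ : ℝ, 0 < ρ ∧ ∀ φ : Test Plane, (∀ y, ρ ≤ ‖y - x‖ → φ y = 0) → ∀ c : ℝ, 0 < c →
      RapidlyDecreasingOn {η : Plane | c * ‖η‖ < |inner ℝ (w : Plane) η|}
        (localFourier (ridge w (f.radon w).filter) φ) := by
  obtain ⟨ε, hε, hg⟩ := exists_rapidlyDecreasingOn_radon_mul f w _ h
  set p : ℝ := inner ℝ x (w : Plane)
  set g : CompactDist ℝ := f.radon w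
  obtain ⟨R, hR, hgR⟩ := g.deriv.exists_ball
  refine ⟨ε / 4, by positivity, fun φ hφ c hc => ?_⟩
  -- The filtered test data live in `|s - p| < ε / 4`, so their Hilbert transform with the kernel cut off
  -- by `B₁` lives in `|s - p| < ε / 2`, where `X = 1`; and `X` is carried by the interval where the
  -- data are smooth. On the ball of radius `R`, which is all that `g` sees, `B₂` cuts off nothing.
  let B₁ : ContDiffBump (0 : ℝ) := ⟨ε / 8, ε / 4, by positivity, by linarith⟩
  let B₂ : ContDiffBump (0 : ℝ) :=
    ⟨R + (|p| + ε / 4), R + (|p| + ε / 4) + 1, by positivity, by linarith⟩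
  let X : ContDiffBump p := ⟨ε / 2, 3 * ε / 4, by positivity, by linarith⟩
  let χ : Smooth ℝ := ⟨fun s => (X s : ℂ), Complex.ofRealCLM.contDiff.comp X.contDiff⟩
  let b₁ : ℝ → ℝ := B₁
  let b₂ : ℝ → ℝ := fun t => B₂ t - B₁ t
  have hb₁ : Continuous b₁ := B₁.continuous
  have hc₁ : HasCompactSupport b₁ := B₁.hasCompactSupport
  have hb₂s : ContDiff ℝ ∞ b₂ := B₂.contDiff.sub B₁.contDiff
  have hb₂ : Continuous b₂ := hb₂s.continuous
  have hc₂ : HasCompactSupport b₂ := B₂.hasCompactSupport.sub B₁.hasCompactSupport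
  have hχ := hg χ fun s hs => by
    have : X s = 0 := X.zero_of_le_dist (by
      rw [Real.dist_eq]
      exact le_trans (by change 3 * ε / 4 ≤ ε; linarith) hs)
    simp [χ, this]
  -- Near part: the multiplier grows at most linearly, and the localized data are smooth.
  have h1 : RapidlyDecreasingOn univ fun σ : ℝ =>
      hilbertSymbol b₁ σ * (g.mul χ).deriv.fourier (2 * Real.pi * σ) := by
    obtain ⟨C, hC, hCσ⟩ := exists_norm_hilbertSymbol_le hb₁ hc₁
    intro N
    obtain ⟨D, hD⟩ := hχ (N + 2)
    refine ⟨C * D, fun σ _ => ?_⟩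
    have h2 := hD (2 * Real.pi * σ) (mem_univ _)
    rw [Real.norm_eq_abs, abs_mul, abs_of_pos Real.two_pi_pos] at h2
    have hσ : |σ| ≤ 2 * Real.pi * |σ| := by nlinarith [Real.pi_gt_three, abs_nonneg σ]
    set F := ‖(g.mul χ).fourier (2 * Real.pi * σ)‖
    set y := 2 * Real.pi * |σ|
    have hy : 0 ≤ y := (abs_nonneg σ).trans hσ
    rw [norm_mul, CompactDist.fourier_deriv, norm_mul, norm_mul, Complex.norm_I, one_mul,
      Complex.norm_real, Real.norm_eq_abs, Real.norm_eq_abs, abs_mul, abs_of_pos Real.two_pi_pos]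
    calc (1 + |σ|) ^ N * (‖hilbertSymbol b₁ σ‖ * (y * F))
        ≤ (1 + y) ^ N * ((C * (1 + y)) * ((1 + y) * F)) := by
          gcongr
          · exact (hCσ σ).trans (by gcongr; linarith)
          · linarith
      _ = C * ((1 + y) ^ (N + 2) * F) := by ring
      _ ≤ C * D := by gcongr
  -- Far part: the multiplier is rapidly decreasing, and the data grow at most polynomially.
  have h0 : (0 : ℝ) ∉ tsupport b₂ := by
    rw [notMem_tsupport_iff_eventuallyEq]
    filter_upwards [B₁.eventuallyEq_one, B₂.eventuallyEq_one] with t ht1 ht2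
    simp [b₂, ht1, ht2]
  have h2 : RapidlyDecreasingOn univ fun σ : ℝ =>
      hilbertSymbol b₂ σ * g.deriv.fourier (2 * Real.pi * σ) := by
    obtain ⟨C, M, hC, hCM⟩ := g.deriv.exists_norm_fourier_le
    intro N
    obtain ⟨D, hD⟩ := rapidlyDecreasingOn_hilbertSymbol hb₂s hc₂
      (fun t => by simp only [b₂, B₁.neg, B₂.neg]) h0 (N + M)
    refine ⟨C * (2 * Real.pi) ^ M * D, fun σ _ => ?_⟩
    have h3 := hD σ (mem_univ _)
    have h4 : ‖g.deriv.fourier (2 * Real.pi * σ)‖ ≤ C * (2 * Real.pi * (1 + ‖σ‖)) ^ M := by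
      refine (hCM _).trans ?_
      gcongr
      rw [norm_mul, Real.norm_of_nonneg Real.two_pi_pos.le]
      nlinarith [Real.pi_gt_three]
    rw [norm_mul]
    calc (1 + ‖σ‖) ^ N * (‖hilbertSymbol b₂ σ‖ * ‖g.deriv.fourier (2 * Real.pi * σ)‖)
        ≤ (1 + ‖σ‖) ^ N * (‖hilbertSymbol b₂ σ‖ * (C * (2 * Real.pi * (1 + ‖σ‖)) ^ M)) := by
          gcongr
      _ = C * (2 * Real.pi) ^ M * ((1 + ‖σ‖) ^ (N + M) * ‖hilbertSymbol b₂ σ‖) := by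
          rw [mul_pow, pow_add]; ring
      _ ≤ _ := by gcongr
  have hkey : localFourier (ridge w g.filter) φ = fun η => -(1 / (4 * Real.pi) : ℂ) *
      ((g.mul χ).deriv.toLin (truncHilbertTest b₁ hb₁ hc₁ (radonTest w (modulate φ η))) +
        g.deriv.toLin (truncHilbertTest b₂ hb₂ hc₂ (radonTest w (modulate φ η)))) := by
    funext η
    set k := radonTest w (modulate φ η)
    have hk : ∀ s, ε / 4 ≤ |s - p| → k s = 0 := fun s hs => radonTest_modulate_eq_zero w hφ η hs
    have hk' : ∀ s, |p| + ε / 4 < |s| → k s = 0 := fun s hs => hk s (by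
      have := abs_sub_abs_le_abs_sub s p
      linarith)
    rw [CompactDist.deriv_toLin_congr g χ _ fun s => ?_, ← map_add]
    · change (1 / (4 * Real.pi) : ℂ) * (-g.deriv.toLin (hilbertTest k)) = _
      rw [neg_mul, mul_neg]
      congr 2
      refine hgR _ _ fun s hs => ?_
      refine hilbertTest_eq_truncHilbert_add k hb₁ hc₁ hb₂ hc₂ hk' (fun t ht htR => ?_) hs
      have : B₂ t = 1 := B₂.one_of_mem_closedBall (by
        rw [mem_closedBall_zero_iff, Real.norm_of_nonneg ht.le]
        exact htR)
      simp [b₁, b₂, this]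
    · by_cases hs : |s - p| ≤ ε / 2
      · left
        have : X s = 1 := X.one_of_mem_closedBall (by
          rw [Metric.mem_closedBall, Real.dist_eq]
          exact hs)
        simp [χ, this]
      · right
        have hopen : IsOpen {s : ℝ | ε / 2 < |s - p|} :=
          isOpen_lt continuous_const (by fun_prop)
        filter_upwards [hopen.mem_nhds (not_le.1 hs)] with s' hs'
        refine truncHilbert_eq_zero hk (δ := ε / 4) (fun t ht => B₁.zero_of_le_dist ?_) ?_
        · rw [Real.dist_eq, sub_zero]
          exact ht
        · linarith
  rw [hkey]
  exact ((rapidlyDecreasingOn_toLin_truncHilbertTest _ hb₁ hc₁ h1 w φ hc).add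
    (rapidlyDecreasingOn_toLin_truncHilbertTest _ hb₂ hc₂ h2 w φ hc)).const_mul _

end Pseudolocality

section Assembly

theorem sampled_add (m j : ℕ) (hm : 0 < m) :
    (sampled m (j + m) : Plane) = -(sampled m j : Plane) := by
  have hm' : (m : ℝ) ≠ 0 := by exact_mod_cast hm.ne'
  have h : Real.pi * ((j : ℝ) + m) / m = Real.pi * j / m + Real.pi := by field_simp
  ext i
  fin_cases i <;> simp [sampled, direction, h, Real.cos_add_pi, Real.sin_add_pi]

theorem mem_conormal_lineThrough {x x₀ ξ : Plane} (w : UnitCircle)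
    (hx : inner ℝ x₀ (w : Plane) = inner ℝ x (w : Plane)) (hξ : inner ℝ (perp w) ξ = (0 : ℝ)) :
    (x, ξ) ∈ conormal (lineThrough x₀ w) := by
  have hmem : ∀ y, y ∈ lineThrough x₀ w ↔ inner ℝ (y - x₀) (w : Plane) = (0 : ℝ) :=
    fun y => Iff.rfl
  refine ⟨(hmem x).2 (by rw [inner_sub_left, hx, sub_self]), fun v hv => ?_⟩
  rw [AffineSubspace.mem_direction_iff_eq_vsub ⟨x₀, (hmem x₀).2 (by simp)⟩] at hv
  obtain ⟨a, ha, b, hb, rfl⟩ := hv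
  rw [hmem] at ha hb
  have h1 : inner ℝ (a -ᵥ b) (w : Plane) = (0 : ℝ) := by
    rw [vsub_eq_sub, ← sub_sub_sub_cancel_right a b x₀, inner_sub_left, ha, hb, sub_zero]
  have h2 := unit_sq w
  generalize a -ᵥ b = v at h1 ⊢
  simp only [PiLp.inner_apply, Fin.sum_univ_two, perp, RCLike.inner_apply, conj_trivial] at *
  simp at hξ
  linear_combination (-(ξ 0 * v 0 + ξ 1 * v 1)) * h2 +
    (ξ 0 * (w : Plane) 0 + ξ 1 * (w : Plane) 1) * h1 +
    (-(w : Plane) 1 * v 0 + (w : Plane) 0 * v 1) * hξ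

theorem inner_ne_zero_of_inner_perp {ξ : Plane} (hξ : ξ ≠ 0) (w : UnitCircle)
    (h : inner ℝ (perp w) ξ = (0 : ℝ)) : inner ℝ (w : Plane) ξ ≠ (0 : ℝ) := by
  intro h0
  have h2 := unit_sq w
  simp only [PiLp.inner_apply, Fin.sum_univ_two, perp, RCLike.inner_apply, conj_trivial] at h h0
  simp at h
  refine hξ ?_
  ext i
  fin_cases i
  · simp
    linear_combination (-(ξ 0)) * h2 + (w : Plane) 0 * h0 - (w : Plane) 1 * h
  · simp
    linear_combination (-(ξ 1)) * h2 + (w : Plane) 1 * h0 + (w : Plane) 0 * h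

/-- The cone of covectors that make an angle bounded away from `π / 2` with `±v`. -/
theorem exists_cone {ξ v : Plane} (h : inner ℝ v ξ ≠ (0 : ℝ)) :
    ∃ c : ℝ, 0 < c ∧ IsOpen {η : Plane | c * ‖η‖ < |inner ℝ v η|} ∧
      ξ ∈ {η : Plane | c * ‖η‖ < |inner ℝ v η|} ∧
      ∀ η ∈ {η : Plane | c * ‖η‖ < |inner ℝ v η|}, ∀ t : ℝ, 0 < t →
        t • η ∈ {η : Plane | c * ‖η‖ < |inner ℝ v η|} := by
  have hξ : ξ ≠ 0 := by
    rintro rfl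
    exact h (inner_zero_right v)
  have hn : 0 < ‖ξ‖ := norm_pos_iff.2 hξ
  have ha : 0 < |inner ℝ v ξ| := abs_pos.2 h
  refine ⟨|inner ℝ v ξ| / (2 * ‖ξ‖), by positivity, ?_, ?_, fun η hη t ht => ?_⟩
  · exact isOpen_lt (by fun_prop) (by fun_prop)
  · rw [mem_ofPred_eq]
    have : |inner ℝ v ξ| / (2 * ‖ξ‖) * ‖ξ‖ = |inner ℝ v ξ| / 2 := by field_simp
    rw [this]
    linarith
  · rw [mem_ofPred_eq] at hη ⊢
    rw [norm_smul, Real.norm_of_nonneg ht.le, inner_smul_right, abs_mul, abs_of_pos ht,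
      mul_left_comm]
    gcongr

theorem localFourier_reconstruction (m : ℕ) (ψ : UnitCircle → ℂ) (f : CompactDist Plane)
    (φ : Test Plane) :
    localFourier (reconstruction m ψ f) φ = fun η => (2 * Real.pi / m : ℂ) *
      ∑ j ∈ Finset.Icc 1 m, ψ (sampled m j) *
        localFourier (ridge (sampled m j) (f.radon (sampled m j)).filter) φ η := by
  funext η
  simp only [localFourier, reconstruction, _root_.smul_apply, _root_.sum_apply,
    smul_eq_mul]

/-- Every term of the reconstruction is rapidly decreasing near `ξ`, for all cutoffs with small
support, unless `(x, ξ)` lies in the conormal bundle of one of the lines. -/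
theorem exists_rapidlyDecreasingOn_term (m : ℕ) (hm : 0 < m) (f : CompactDist Plane)
    {x ξ : Plane} (hξ : ξ ≠ 0)
    (hne : ∀ j ∈ Finset.Icc 1 (2 * m), ∀ x₀ : Plane,
      (x₀, (sampled m j : Plane)) ∈ WF f.toDist →
        (x, ξ) ∉ conormal (lineThrough x₀ (sampled m j)))
    {j : ℕ} (hj : j ∈ Finset.Icc 1 m) :
    ∃ ρ : ℝ, 0 < ρ ∧ ∀ φ : Test Plane, (∀ y, ρ ≤ ‖y - x‖ → φ y = 0) →
      ∃ Γ : Set Plane, IsOpen Γ ∧ ξ ∈ Γ ∧ (∀ η ∈ Γ, ∀ t : ℝ, 0 < t → t • η ∈ Γ) ∧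
        RapidlyDecreasingOn Γ
          (localFourier (ridge (sampled m j) (f.radon (sampled m j)).filter) φ) := by
  have hj' := Finset.mem_Icc.1 hj
  by_cases hp : inner ℝ (perp (sampled m j)) ξ = (0 : ℝ)
  -- The covector is parallel to `ω_j`. The opposite direction `-ω_j = ω_{j+m}` is sampled as well.
  · obtain ⟨ρ, hρ, hdec⟩ := exists_rapidlyDecreasingOn_ridge_filter f (sampled m j) x
      fun x₀ hx₀ => by
        refine ⟨fun hw => ?_, fun hw => ?_⟩
        · exact hne j (Finset.mem_Icc.2 ⟨hj'.1, by omega⟩) x₀ hw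
            (mem_conormal_lineThrough (sampled m j) hx₀ hp)
        · rw [← sampled_add m j hm] at hw
          refine hne (j + m) (Finset.mem_Icc.2 ⟨by omega, by omega⟩) x₀ hw
            (mem_conormal_lineThrough (sampled m (j + m)) ?_ ?_)
          · rw [sampled_add m j hm, inner_neg_right, inner_neg_right, hx₀]
          · have : perp (-(sampled m j : Plane)) = -perp (sampled m j) := by
              ext i
              fin_cases i <;> simp [perp]
            rw [sampled_add m j hm, this, inner_neg_left, hp, neg_zero]
    obtain ⟨c, hc, hΓ, hmem, hcone⟩ := exists_cone (inner_ne_zero_of_inner_perp hξ _ hp)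
    exact ⟨ρ, hρ, fun φ hφ => ⟨_, hΓ, hmem, hcone, hdec φ hφ c hc⟩⟩
  -- The covector is not parallel to `ω_j`, and the term is constant along the lines `x·ω_j = s`.
  · obtain ⟨c, hc, hΓ, hmem, hcone⟩ := exists_cone hp
    exact ⟨1, one_pos, fun φ _ => ⟨_, hΓ, hmem, hcone,
      rapidlyDecreasingOn_localFourier_of_dirDeriv (ridge_dirDeriv_perp _ _) φ hc⟩⟩

theorem Test.exists_bump {V : Type*} [NormedAddCommGroup V] [InnerProductSpace ℝ V]
    [FiniteDimensional ℝ V] (x : V) {ρ : ℝ} (hρ : 0 < ρ) :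
    ∃ φ : Test V, φ x ≠ 0 ∧ ∀ y, ρ ≤ ‖y - x‖ → φ y = 0 := by
  let B : ContDiffBump x := ⟨ρ / 2, ρ, by positivity, by linarith⟩
  refine ⟨⟨fun y => (B y : ℂ), Complex.ofRealCLM.contDiff.comp B.contDiff,
    B.hasCompactSupport.comp_left Complex.ofReal_zero, fun _ _ => trivial⟩, ?_, fun y hy => ?_⟩
  · change (B x : ℂ) ≠ 0
    rw [B.eventuallyEq_one.eq_of_nhds]
    simp
  · change (B y : ℂ) = 0
    rw [B.zero_of_le_dist (by rw [dist_eq_norm]; exact hy), Complex.ofReal_zero]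

/-- A point of the wave front set of the reconstruction is conormal to a line in one of the sampled
directions through a point at which `f` is singular in that direction. -/
theorem mem_of_mem_WF_reconstruction (m : ℕ) (hm : 0 < m) (ψ : UnitCircle → ℂ)
    (f : CompactDist Plane) {x ξ : Plane} (hq : (x, ξ) ∈ WF (reconstruction m ψ f)) :
    ∃ j ∈ Finset.Icc 1 (2 * m), ∃ x₀ : Plane,
      (x₀, (sampled m j : Plane)) ∈ WF f.toDist ∧
        (x, ξ) ∈ conormal (lineThrough x₀ (sampled m j)) := by
  by_contra hcon
  obtain ⟨hξ, hsmooth⟩ := hq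
  refine hsmooth ?_
  have hne : ∀ j ∈ Finset.Icc 1 (2 * m), ∀ x₀ : Plane,
      (x₀, (sampled m j : Plane)) ∈ WF f.toDist →
        (x, ξ) ∉ conormal (lineThrough x₀ (sampled m j)) :=
    fun j hj x₀ h1 h2 => hcon ⟨j, hj, x₀, h1, h2⟩
  choose! ρ hρ hdec using fun j (hj : j ∈ Finset.Icc 1 m) =>
    exists_rapidlyDecreasingOn_term m hm f hξ hne hj
  obtain ⟨r, hr, hrρ⟩ : ∃ r : ℝ, 0 < r ∧ ∀ j ∈ Finset.Icc 1 m, r ≤ ρ j := by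
    have h1 : (Finset.Icc 1 m).Nonempty := Finset.nonempty_Icc.2 hm
    exact ⟨(Finset.Icc 1 m).inf' h1 ρ, (Finset.lt_inf'_iff h1).2 hρ,
      fun j hj => Finset.inf'_le ρ hj⟩
  obtain ⟨φ, hφx, hφ⟩ := Test.exists_bump x hr
  choose! Γ hΓ hmem hcone hΓdec using fun j (hj : j ∈ Finset.Icc 1 m) =>
    hdec j hj φ fun y hy => hφ y ((hrρ j hj).trans hy)
  refine ⟨φ, hφx, ⋂ j ∈ Finset.Icc 1 m, Γ j, isOpen_biInter_finset hΓ, mem_iInter₂.2 hmem,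
    fun η hη t ht => mem_iInter₂.2 fun j hj => hcone j hj η (mem_iInter₂.1 hη j hj) t ht, ?_⟩
  rw [← rapidlyDecreasingOn_iff, localFourier_reconstruction]
  exact (RapidlyDecreasingOn.sum _ fun j hj =>
    ((hΓdec j hj).mono (biInter_subset_of_mem hj)).const_mul _).const_mul _

end Assembly

end RadonWF

end

theorem theorem3p1 (m : ℕ) (hm : 0 < m)
    (ψ : RadonWF.UnitCircle → ℂ)
    (hψ : ContMDiff (𝓡 1) (modelWithCornersSelf ℝ ℂ) ∞ ψ)
    (hψ_even : ∀ w : RadonWF.UnitCircle, ψ (-w) = ψ w)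
    (f : RadonWF.CompactDist RadonWF.Plane) :
    RadonWF.WF (RadonWF.reconstruction m ψ f) ⊆
      {q | ∃ j ∈ Finset.Icc 1 (2 * m), ∃ x₀ : RadonWF.Plane,
        (x₀, (RadonWF.sampled m j : RadonWF.Plane)) ∈ RadonWF.WF f.toDist ∧
        q ∈ RadonWF.conormal (RadonWF.lineThrough x₀ (RadonWF.sampled m j))} :=
  fun _ hq => RadonWF.mem_of_mem_WF_reconstruction m hm ψ f hq
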